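/- Let $r\in\{6,7,8\}$ and let $\vec E_r$ be the Dynkin quiver with nodes $1,\dots,r$ and arrows $1\to 2\to r$, $\;r-1\to r$ and $3\to 4\to\cdots\to r-2\to r$. Let $\mathscr D=D^b(\mathsf{mod}\,\mathbb C\vec E_r)$ be the bounded derived category of finite-dimensional complex representations of $\vec E_r$, with shift $[1]$, Serre functor $S$ (so that $\mathrm{Hom}(Z,SX)\cong \mathrm{Hom}(X,Z)^*$ naturally in $Z$), and Auslander–Reiten translation $\tau=S[-1]$. The root category $\mathscr R(E_r)=\mathscr D/[2\mathbb Z]$ has the objects of $\mathscr D$, the morphism spaces $$\mathrm{Hom}_{\mathscr R}(X,Y)=\bigoplus_{k\in\mathbb Z}\mathrm{Hom}_{\mathscr D}(X,Y[2k])$$ and the composition induced by that of $\mathscr D$; write $[1]$ and $\tau$ also for the induced operations on $\mathscr R(E_r)$. An object $A$ of $\mathscr R(E_r)$ has a *spherical orbit of period $p$* (respectively a *spherical half-orbit of half-period $p$*) if $p$ is the smallest positive integer such that $\tau^pA\cong A$ (respectively $\tau^pA\cong A[1]$) in $\mathscr R(E_r)$ and $$\sum_{k=0}^{p-1}\Big(\dim\mathrm{Hom}_{\mathscr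 R}(A,\tau^kA)+\dim\mathrm{Hom}_{\mathscr R}(A,\tau^kA[1])\Big)=2 .$$ Then no object of $\mathscr R(E_6)$, $\mathscr R(E_7)$ or $\mathscr R(E_8)$ has a spherical orbit or a spherical half-orbit, of any (half-)period. -/

import Mathlib

open CategoryTheory CategoryTheory.Limits

noncomputable section

/-! ### Quivers of type `E_r` and their representations -/

/-- The vertices of the Dynkin quiver of type `E_r`. The vertex `i : Fin r` is the node usually
numbered `i + 1`, so that the nodes are `1, …, r`. -/
structure EVertex (r : ℕ) where
  idx : Fin r

/-- The number in `{1, …, r}` of a vertex. -/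
def EVertex.num {r : ℕ} (v : EVertex r) : ℕ := v.idx.val + 1

/-- The arrows of the quiver of type `E_r`, on the nodes `1, …, r`:
`1 ⟶ 2 ⟶ r`, `r - 1 ⟶ r` and `3 ⟶ 4 ⟶ ⋯ ⟶ r - 2 ⟶ r`. The node `r` is the trivalent one; its arms
have `2`, `1` and `r - 4` nodes. -/
def EVertex.IsArrow {r : ℕ} (v w : EVertex r) : Prop :=
  (v.num = 1 ∧ w.num = 2) ∨
  (v.num = 2 ∧ w.num = r) ∨
  (v.num + 1 = r ∧ w.num = r) ∨
  (v.num + 2 = r ∧ w.num = r) ∨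
  (3 ≤ v.num ∧ v.num + 3 ≤ r ∧ w.num = v.num + 1)

instance (r : ℕ) : Quiver (EVertex r) where
  Hom v w := PLift (v.IsArrow w)

/-- The abelian category of finite-dimensional complex representations of the quiver of type `E_r`,
that is, of finite-dimensional modules over its path algebra. -/
abbrev ERep (r : ℕ) : Type 1 := Paths (EVertex r) ⥤ FGModuleCat.{0} ℂ

/-! ### The bounded derived category -/

instance (r : ℕ) : HasDerivedCategory.{1} (ERep r) := HasDerivedCategory.standard _

/-- The bounded derived category `D^b(mod ℂE_r)`: the full subcategory of the derived category on
the complexes with bounded cohomology. -/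
abbrev EDerived (r : ℕ) : Type 1 :=
  (DerivedCategory.TStructure.t (C := ERep r)).bounded.FullSubcategory

instance (r : ℕ) (n : ℤ) : (shiftFunctor (EDerived r) n).Linear ℂ where
  map_smul {X Y} f c := by
    let ι := (DerivedCategory.TStructure.t (C := ERep r)).bounded.ι
    apply ι.map_injective
    rw [← cancel_mono ((ι.commShiftIso n).hom.app Y)]
    have h := fun g : X ⟶ Y => (ι.commShiftIso n).hom.naturality g
    simp only [Functor.comp_obj, Functor.comp_map] at h
    rw [h, Functor.map_smul ι, Functor.map_smul, Linear.comp_smul, Functor.map_smul ι,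
      Linear.smul_comp, h]

/-! ### The orbit category by the square of the shift -/

section Orbit

universe v u

variable {C : Type u} [Category.{v} C] [HasShift C ℤ]

theorem shiftedHom_comp_heq {X Y Z : C} {a b c c' : ℤ} (f : ShiftedHom X Y a) (g : ShiftedHom Y Z b)
    (h : b + a = c) (h' : b + a = c') : HEq (f.comp g h) (f.comp g h') := by
  subst h
  subst h'
  rfl

variable [Preadditive C] [Linear ℂ C]

/-- Morphisms in the orbit category `C / [2ℤ]`: the space `⨁_{k ∈ ℤ} Hom(X, Y[2k])`. -/
abbrev OrbitHom (X Y : C) : Type v := DirectSum ℤ fun k : ℤ => (X ⟶ Y⟦2 * k⟧)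

theorem orbit_lof_congr (X Z : C) {a b : ℤ} (h : a = b) (f : X ⟶ Z⟦2 * a⟧) (g : X ⟶ Z⟦2 * b⟧)
    (hfg : HEq f g) :
    DirectSum.lof ℂ ℤ (fun m : ℤ => (X ⟶ Z⟦2 * m⟧)) a f =
      DirectSum.lof ℂ ℤ (fun m : ℤ => (X ⟶ Z⟦2 * m⟧)) b g := by
  subst h
  rw [eq_of_heq hfg]

variable [∀ n : ℤ, (shiftFunctor C n).Additive] [∀ n : ℤ, (shiftFunctor C n).Linear ℂ]

/-- The composition of `f : X ⟶ Y[2k]` and `g : Y ⟶ Z[2l]`, namely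
`X ⟶ Y[2k] ⟶ Z[2l][2k] = Z[2(k + l)]`, as a bilinear map with values in the orbit morphisms. -/
def orbitCompAux (X Y Z : C) (k l : ℤ) :
    (X ⟶ Y⟦2 * k⟧) →ₗ[ℂ] (Y ⟶ Z⟦2 * l⟧) →ₗ[ℂ] OrbitHom X Z :=
  LinearMap.mk₂ ℂ
    (fun f g => DirectSum.lof ℂ ℤ (fun m : ℤ => (X ⟶ Z⟦2 * m⟧)) (k + l)
      (ShiftedHom.comp (X := X) (Y := Y) (Z := Z) f g (by ring)))
    (fun f f' g => by rw [ShiftedHom.add_comp, map_add])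
    (fun c f g => by rw [ShiftedHom.smul_comp, map_smul])
    (fun f g g' => by rw [ShiftedHom.comp_add, map_add])
    (fun c f g => by rw [ShiftedHom.comp_smul, map_smul])

/-- Composition in the orbit category, extended bilinearly from homogeneous morphisms. -/
def orbitComp (X Y Z : C) : OrbitHom X Y →ₗ[ℂ] OrbitHom Y Z →ₗ[ℂ] OrbitHom X Z :=
  DirectSum.toModule ℂ ℤ _ fun k =>
    (DirectSum.toModule ℂ ℤ _ fun l => (orbitCompAux X Y Z k l).flip).flip

/-- The identity in the orbit category, concentrated in degree `0`. -/
def orbitId (X : C) : OrbitHom X X :=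
  DirectSum.lof ℂ ℤ (fun m : ℤ => (X ⟶ X⟦2 * m⟧)) 0
    (ShiftedHom.mk₀ (X := X) (Y := X) (2 * 0 : ℤ) (by simp) (𝟙 X))

theorem orbitComp_lof (X Y Z : C) (k l : ℤ) (f : X ⟶ Y⟦2 * k⟧) (g : Y ⟶ Z⟦2 * l⟧) :
    orbitComp X Y Z (DirectSum.lof ℂ ℤ (fun m : ℤ => (X ⟶ Y⟦2 * m⟧)) k f)
      (DirectSum.lof ℂ ℤ (fun m : ℤ => (Y ⟶ Z⟦2 * m⟧)) l g) =
    DirectSum.lof ℂ ℤ (fun m : ℤ => (X ⟶ Z⟦2 * m⟧)) (k + l)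
      (ShiftedHom.comp (X := X) (Y := Y) (Z := Z) f g (by ring)) := by
  simp [orbitComp, orbitCompAux]

theorem orbitId_comp (X Y : C) (f : OrbitHom X Y) : orbitComp X X Y (orbitId X) f = f := by
  induction f using DirectSum.induction_on with
  | zero => simp
  | add f g hf hg => rw [map_add, hf, hg]
  | of k f =>
    refine (orbitComp_lof X X Y 0 k _ f).trans (orbit_lof_congr X Y (zero_add k) _ f ?_)
    exact (shiftedHom_comp_heq _ _ _ (by ring)).trans
      (heq_of_eq (ShiftedHom.mk₀_id_comp (2 * 0 : ℤ) (by simp) f))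

theorem orbitComp_id (X Y : C) (f : OrbitHom X Y) : orbitComp X Y Y f (orbitId Y) = f := by
  induction f using DirectSum.induction_on with
  | zero => simp
  | add f g hf hg => rw [map_add, LinearMap.add_apply, hf, hg]
  | of k f =>
    refine (orbitComp_lof X Y Y k 0 f _).trans (orbit_lof_congr X Y (add_zero k) _ f ?_)
    exact (shiftedHom_comp_heq _ _ _ (by ring)).trans
      (heq_of_eq (ShiftedHom.comp_mk₀_id f (2 * 0 : ℤ) (by simp)))

theorem orbitComp_assoc (X Y Z W : C) (f : OrbitHom X Y) (g : OrbitHom Y Z) (h : OrbitHom Z W) :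
    orbitComp X Z W (orbitComp X Y Z f g) h = orbitComp X Y W f (orbitComp Y Z W g h) := by
  induction f using DirectSum.induction_on with
  | zero => simp
  | add f f' hf hf' => simp only [map_add, LinearMap.add_apply, hf, hf']
  | of k f =>
    induction g using DirectSum.induction_on with
    | zero => simp
    | add g g' hg hg' => simp only [map_add, LinearMap.add_apply, hg, hg']
    | of l g =>
      induction h using DirectSum.induction_on with
      | zero => simp
      | add h h' hh hh' => simp only [map_add, hh, hh']
      | of m h =>
        have e1 := orbitComp_lof X Y Z k l f g
        have e2 := orbitComp_lof Y Z W l m g h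
        simp only [DirectSum.lof_eq_of] at e1 e2
        rw [e1, e2]
        refine (orbitComp_lof X Z W (k + l) m _ h).trans
          (Eq.trans ?_ (orbitComp_lof X Y W k (l + m) f _).symm)
        refine orbit_lof_congr X W (add_assoc k l m) _ _ ?_
        exact (shiftedHom_comp_heq _ _ _ (by ring)).trans
          ((heq_of_eq (ShiftedHom.comp_assoc (a₁₂ := 2 * (k + l)) (a₂₃ := 2 * (l + m))
            (a := 2 * (k + l + m)) f g h (by ring) (by ring) (by ring))).trans
            (shiftedHom_comp_heq _ _ _ _))

end Orbit

/-! ### The root category -/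

/-- The root category `R(E_r) = D^b(mod ℂE_r) / [2ℤ]`: it has the same objects as
`D^b(mod ℂE_r)`. -/
structure RootCategory (r : ℕ) where
  /-- The underlying object of the bounded derived category. -/
  obj : EDerived r

/-- A morphism of the root category is an element of `⨁_{k ∈ ℤ} Hom(X, Y[2k])`. -/
instance (r : ℕ) : Category (RootCategory r) where
  Hom X Y := OrbitHom X.obj Y.obj
  id X := orbitId X.obj
  comp {X Y Z} f g := orbitComp X.obj Y.obj Z.obj f g
  id_comp {X Y} f := orbitId_comp X.obj Y.obj f
  comp_id {X Y} f := orbitComp_id X.obj Y.obj f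
  assoc {X Y Z W} f g h := orbitComp_assoc X.obj Y.obj Z.obj W.obj f g h

instance (r : ℕ) : Preadditive (RootCategory r) where
  homGroup X Y := inferInstanceAs (AddCommGroup (OrbitHom X.obj Y.obj))
  add_comp X Y Z f f' g := (orbitComp X.obj Y.obj Z.obj).map_add₂ f f' g
  comp_add X Y Z f g g' := (orbitComp X.obj Y.obj Z.obj f).map_add g g'

instance (r : ℕ) : Linear ℂ (RootCategory r) where
  homModule X Y := inferInstanceAs (Module ℂ (OrbitHom X.obj Y.obj))
  smul_comp X Y Z c f g := (orbitComp X.obj Y.obj Z.obj).map_smul₂ c f g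
  comp_smul X Y Z f c g := (orbitComp X.obj Y.obj Z.obj f).map_smul c g

/-- The shift `X[n]` of an object of the root category. -/
def RootCategory.shift {r : ℕ} (X : RootCategory r) (n : ℤ) : RootCategory r := ⟨X.obj⟦n⟧⟩

/-! ### The Serre functor and the Auslander–Reiten translation on objects -/

/-- `Y ≅ S X` for the Serre functor `S`: the object `Y` represents the functor
`Z ↦ Hom(X, Z)^*`, that is, there are linear isomorphisms `Hom(Z, Y) ≃ Hom(X, Z)^*`
natural in `Z`. -/
def IsSerreDual {C : Type*} [Category* C] [Preadditive C] [Linear ℂ C] (X Y : C) : Prop :=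
  ∃ e : ∀ Z : C, (Z ⟶ Y) ≃ₗ[ℂ] Module.Dual ℂ (X ⟶ Z),
    ∀ (Z W : C) (a : Z ⟶ W) (g : W ⟶ Y) (f : X ⟶ Z), e Z (a ≫ g) f = e W g (f ≫ a)

/-- `B 0, B 1, B 2, …` is the `τ`-orbit `A, τA, τ²A, …` of `A` in the root category, where `τ` is
the image of the Auslander–Reiten translation `τ = S[-1]` of `D^b(mod ℂE_r)`. The equality
`τ X = Y` is spelled out as `S X = Y[1]`. The sequence is determined by `A` up to isomorphism. -/
def IsTauOrbit {r : ℕ} (A : RootCategory r) (B : ℕ → RootCategory r) : Prop :=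
  B 0 = A ∧ ∀ k, IsSerreDual (B k).obj ((B (k + 1)).obj⟦(1 : ℤ)⟧)

/-! ### Spherical orbits and half-orbits -/

/-- `∑_{k=0}^{p-1} (dim Hom(A, B k) + dim Hom(A, (B k)[1])) = 2`, in the root category. -/
def HasSphericalSum {r : ℕ} (A : RootCategory r) (B : ℕ → RootCategory r) (p : ℕ) : Prop :=
  ∑ k ∈ Finset.range p,
    (Module.rank ℂ (A ⟶ B k) + Module.rank ℂ (A ⟶ (B k).shift 1)) = 2

/-- `A` has a spherical `τ`-orbit of period `p`: `p` is the least positive integer such that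
`τ^p A ≅ A`, and `∑_{k=0}^{p-1} (dim Hom(A, τ^k A) + dim Hom(A, τ^k A[1])) = 2`. -/
def HasSphericalOrbit {r : ℕ} (A : RootCategory r) (p : ℕ) : Prop :=
  ∃ B : ℕ → RootCategory r, IsTauOrbit A B ∧
    IsLeast {q : ℕ | 0 < q ∧ Nonempty (B q ≅ A)} p ∧ HasSphericalSum A B p

/-- `A` has a spherical `τ`-half-orbit of half-period `q`: `q` is the least positive integer such
that `τ^q A ≅ A[1]`, and `∑_{k=0}^{q-1} (dim Hom(A, τ^k A) + dim Hom(A, τ^k A[1])) = 2`. -/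
def HasSphericalHalfOrbit {r : ℕ} (A : RootCategory r) (q : ℕ) : Prop :=
  ∃ B : ℕ → RootCategory r, IsTauOrbit A B ∧
    IsLeast {p : ℕ | 0 < p ∧ Nonempty (B p ≅ A.shift 1)} q ∧ HasSphericalSum A B q

end

noncomputable section

/-! ### Euler characteristics of long exact sequences -/

/-! Summing `Hom` in the root category into an object and into its shift gives the total dimension
of the graded space `Hom^*` in the derived category, while the even part minus the odd part is the
Euler form. The problem thereby moves to the Grothendieck group: the classes of the indecomposable
projectives identify it with `ℤ^r`, the Euler form becomes the Cartan matrix, and `τ` acts as the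
Coxeter transformation `c`, because Serre duality reads `χ(Z, τX) = -χ(X, Z)`
(`Generates.exists_class`, `IsSerreDual.eulerForm_eq_neg`).

Let `y` be the class of `A`. An orbit or half-orbit gives `c^p y = s y` with `s = 1` or `s = -1`;
both cases are treated together in `IsTauOrbit.false_of_hasSphericalSum`.

If `p ≥ 2`, Serre duality makes the total dimensions of `Hom^*(A, A)` and `Hom^*(A, τA)` equal.
Since `A` is nonzero, both are 1 and all other terms vanish. So `g k = χ(A, τ^k A)` starts with `1,
-1, 0, …, 0` for `k < p`, satisfies `g (k + p) = s * g k`, and obeys the recurrence given by the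
characteristic polynomial of `c`. This leaves only `p = 3` for `E_6` and `p = 2` for `E_7`, both
with `s = 1`. On the vectors fixed by that power of `c` the quadratic form is even, respectively
divisible by 3, contradicting `χ(A, A) = 1` (`not_coxeter_periodic`).

If `p = 1`, then `χ(A, A)` is 2, or it is 0 and `End A` is one-dimensional. The form on vectors with
`c y = s y` never takes the value 2, and takes the value 0 only at `y = 0`
(`eForm_self_ne_of_coxeter_fixed`). Now an object with one-dimensional endomorphism space is a
shifted representation, as the category is hereditary, and a representation with zero class is zero
(`isZero_of_eulerForm_eProj_eq_zero`). -/

theorem finrank_eq_of_exact {K V₁ V₂ V₃ : Type*} [Field K] [AddCommGroup V₁] [Module K V₁]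
    [AddCommGroup V₂] [Module K V₂] [AddCommGroup V₃] [Module K V₃] [FiniteDimensional K V₂]
    (f : V₁ →ₗ[K] V₂) (g : V₂ →ₗ[K] V₃) (h : Function.Exact f g) :
    Module.finrank K V₂ =
      Module.finrank K (LinearMap.range f) + Module.finrank K (LinearMap.range g) := by
  rw [← LinearMap.finrank_range_add_finrank_ker g, h.linearMap_ker_eq, add_comm]

theorem finiteDimensional_of_exact {K V₁ V₂ V₃ : Type*} [Field K] [AddCommGroup V₁] [Module K V₁]
    [AddCommGroup V₂] [Module K V₂] [AddCommGroup V₃] [Module K V₃] [FiniteDimensional K V₁]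
    [FiniteDimensional K V₃] (f : V₁ →ₗ[K] V₂) (g : V₂ →ₗ[K] V₃) (h : Function.Exact f g) :
    FiniteDimensional K V₂ := by
  have : FiniteDimensional K (LinearMap.ker g) := by
    rw [h.linearMap_ker_eq]; infer_instance
  have : FiniteDimensional K (V₂ ⧸ LinearMap.ker g) :=
    LinearEquiv.finiteDimensional g.quotKerEquivRange.symm
  exact Module.Finite.of_submodule_quotient (LinearMap.ker g)

/-- The alternating sum `∑_n (-1)^n d(n)` of a finitely supported sequence. -/
def alternatingSum (d : ℤ → ℕ) : ℤ := ∑ᶠ n : ℤ, (n.negOnePow : ℤ) * d n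

theorem alternatingSum_add {d e : ℤ → ℕ} (hd : (Function.support d).Finite)
    (he : (Function.support e).Finite) :
    alternatingSum (fun n => d n + e n) = alternatingSum d + alternatingSum e := by
  unfold alternatingSum
  rw [← finsum_add_distrib]
  · exact finsum_congr fun n => by push_cast; ring
  · exact hd.subset fun n hn => by
      simp only [Function.mem_support] at hn ⊢
      rintro h; simp [h] at hn
  · exact he.subset fun n hn => by
      simp only [Function.mem_support] at hn ⊢
      rintro h; simp [h] at hn

theorem alternatingSum_shift (d : ℤ → ℕ) (a : ℤ) :
    alternatingSum (fun n => d (n + a)) = (a.negOnePow : ℤ) * alternatingSum d := by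
  unfold alternatingSum
  rw [← finsum_comp_equiv (Equiv.addRight a) (f := fun n : ℤ => (n.negOnePow : ℤ) * d n),
    ← smul_eq_mul, smul_finsum]
  refine finsum_congr fun n => ?_
  simp only [Equiv.coe_addRight, smul_eq_mul, Int.negOnePow_add, Units.val_mul]
  rcases Int.units_eq_one_or a.negOnePow with h | h <;> simp [h]

/-- With `a`, `b`, `c` the ranks of `f`, `g`, `δ`, the three dimensions in degree `n` are `c (n - 1)
+ a n`, `a n + b n` and `b n + c n`. The two contributions of `c` cancel because they are one degree
apart. Finiteness has to be carried along, since `alternatingSum` is zero by default on a sequence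
with infinite support. -/
theorem finite_support_and_alternatingSum_of_exact {K : Type*} [Field K] (V₁ V₂ V₃ : ℤ → Type*)
    [∀ n, AddCommGroup (V₁ n)] [∀ n, Module K (V₁ n)] [∀ n, AddCommGroup (V₂ n)]
    [∀ n, Module K (V₂ n)] [∀ n, AddCommGroup (V₃ n)] [∀ n, Module K (V₃ n)]
    (f : ∀ n, V₁ n →ₗ[K] V₂ n) (g : ∀ n, V₂ n →ₗ[K] V₃ n) (δ : ∀ n, V₃ n →ₗ[K] V₁ (n + 1))
    (hfg : ∀ n, Function.Exact (f n) (g n)) (hgδ : ∀ n, Function.Exact (g n) (δ n))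
    (hδf : ∀ n, Function.Exact (δ n) (f (n + 1)))
    [∀ n, FiniteDimensional K (V₁ n)] [∀ n, FiniteDimensional K (V₃ n)]
    (h₁ : (Function.support fun n => Module.finrank K (V₁ n)).Finite)
    (h₃ : (Function.support fun n => Module.finrank K (V₃ n)).Finite) :
    (Function.support fun n => Module.finrank K (V₂ n)).Finite ∧
      alternatingSum (fun n => Module.finrank K (V₂ n)) =
        alternatingSum (fun n => Module.finrank K (V₁ n)) +
          alternatingSum (fun n => Module.finrank K (V₃ n)) := by
  have _ := fun n => finiteDimensional_of_exact _ _ (hfg n)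
  have e₂ := fun n => finrank_eq_of_exact _ _ (hfg n)
  have e₃ := fun n => finrank_eq_of_exact _ _ (hgδ n)
  have e₁ := fun n => finrank_eq_of_exact _ _ (hδf n)
  set a : ℤ → ℕ := fun n => Module.finrank K (LinearMap.range (f n)) with ha
  set b : ℤ → ℕ := fun n => Module.finrank K (LinearMap.range (g n)) with hb
  set c : ℤ → ℕ := fun n => Module.finrank K (LinearMap.range (δ n)) with hc
  have e₁' : ∀ n, Module.finrank K (V₁ n) = c (n + (-1)) + a n := fun n => by
    have := e₁ (n + (-1))
    have key : ∀ m : ℤ, m = n → Module.finrank K (V₁ m) = c (n + (-1)) +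
        Module.finrank K (LinearMap.range (f m)) → Module.finrank K (V₁ n) = c (n + (-1)) + a n := by
      rintro m rfl h; exact h
    exact key _ (by ring) this
  have e₂' : ∀ n, Module.finrank K (V₂ n) = a n + b n := e₂
  have e₃' : ∀ n, Module.finrank K (V₃ n) = b n + c n := e₃
  simp only [e₁'] at h₁
  simp only [e₃'] at h₃
  have fa : (Function.support a).Finite := h₁.subset fun n hn => by
    simp only [Function.mem_support] at hn ⊢; lia
  have fc' : (Function.support fun n => c (n + (-1))).Finite := h₁.subset fun n hn => by
    simp only [Function.mem_support] at hn ⊢; lia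
  have fb : (Function.support b).Finite := h₃.subset fun n hn => by
    simp only [Function.mem_support] at hn ⊢; lia
  have fc : (Function.support c).Finite := h₃.subset fun n hn => by
    simp only [Function.mem_support] at hn ⊢; lia
  simp only [e₁', e₂', e₃']
  refine ⟨(fa.union fb).subset fun n hn => ?_, ?_⟩
  · simp only [Function.mem_support, Set.mem_union] at hn ⊢; lia
  · rw [alternatingSum_add fa fb, alternatingSum_add fc' fa, alternatingSum_add fb fc,
      alternatingSum_shift c (-1)]
    simp
    ring

/-! ### The Euler form of a linear triangulated category -/

section EulerForm

set_option linter.unusedSectionVars false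

open CategoryTheory.Pretriangulated

universe v u

variable {C : Type u} [Category.{v} C] [Preadditive C] [HasShift C ℤ] [Linear ℂ C]

/-- The dimension of `Hom(A, B[n])`. -/
def homDim (A B : C) (n : ℤ) : ℕ := Module.finrank ℂ (A ⟶ B⟦n⟧)

/-- The Euler form `∑_n (-1)^n dim Hom(A, B[n])`. -/
def eulerForm (A B : C) : ℤ := alternatingSum (homDim A B)

/-- The spaces `Hom(A, B[n])` are finite-dimensional and almost all zero. -/
structure HomFinite (A B : C) : Prop where
  finiteDimensional (n : ℤ) : FiniteDimensional ℂ (A ⟶ B⟦n⟧)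
  finite_support : (Function.support (homDim A B)).Finite

variable [∀ n : ℤ, (shiftFunctor C n).Additive] [∀ n : ℤ, (shiftFunctor C n).Linear ℂ]

/-- `Hom(A[a], B[n + a])` and `Hom(A, B[n])` are isomorphic. -/
def homShiftLeftEquiv (A B : C) (a n m : ℤ) (h : n + a = m) :
    (A ⟶ B⟦n⟧) ≃ₗ[ℂ] (A⟦a⟧ ⟶ B⟦m⟧) :=
  (LinearEquiv.ofBijective ((shiftFunctor C a).mapLinearMap ℂ (X := A) (Y := B⟦n⟧))
    ⟨(shiftFunctor C a).map_injective, (shiftFunctor C a).map_surjective⟩).trans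
    (Linear.homCongr ℂ (Iso.refl _) ((shiftFunctorAdd' C n a m h).symm.app B))

theorem homShiftLeftEquiv_apply (A B : C) (a n m : ℤ) (h : n + a = m) (f : A ⟶ B⟦n⟧) :
    homShiftLeftEquiv A B a n m h f = f⟦a⟧' ≫ (shiftFunctorAdd' C n a m h).inv.app B := by
  simp only [homShiftLeftEquiv, LinearEquiv.trans_apply, Linear.homCongr_apply, Iso.refl_inv,
    Category.id_comp]
  rfl

/-- `Hom(A, B[a][n])` and `Hom(A, B[a + n])` are isomorphic. -/
def homShiftRightEquiv (A B : C) (a n m : ℤ) (h : a + n = m) :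
    (A ⟶ B⟦a⟧⟦n⟧) ≃ₗ[ℂ] (A ⟶ B⟦m⟧) :=
  Linear.homCongr ℂ (Iso.refl _) ((shiftFunctorAdd' C a n m h).symm.app B)

theorem homDim_shift_left (A B : C) (a : ℤ) :
    homDim (A⟦a⟧) B = fun n => homDim A B (n + (-a)) :=
  funext fun n => (homShiftLeftEquiv A B a (n + -a) n (by ring)).finrank_eq.symm

theorem homDim_shift_right (A B : C) (a : ℤ) :
    homDim A (B⟦a⟧) = fun n => homDim A B (n + a) :=
  funext fun n => (homShiftRightEquiv A B a n (n + a) (by ring)).finrank_eq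

theorem homDim_congr {A A' B B' : C} (e : A ≅ A') (e' : B ≅ B') : homDim A B = homDim A' B' :=
  funext fun n => (Linear.homCongr ℂ e ((shiftFunctor C n).mapIso e')).finrank_eq

theorem eulerForm_shift_left (A B : C) (a : ℤ) :
    eulerForm (A⟦a⟧) B = (a.negOnePow : ℤ) * eulerForm A B := by
  unfold eulerForm
  rw [homDim_shift_left, alternatingSum_shift, Int.negOnePow_neg]

theorem eulerForm_shift_right (A B : C) (a : ℤ) :
    eulerForm A (B⟦a⟧) = (a.negOnePow : ℤ) * eulerForm A B := by
  unfold eulerForm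
  rw [homDim_shift_right, alternatingSum_shift]

theorem finite_support_comp_add {d : ℤ → ℕ} (h : (Function.support d).Finite) (a : ℤ) :
    (Function.support fun n => d (n + a)).Finite :=
  Set.Finite.preimage (f := fun n => n + a) (add_left_injective a).injOn h

theorem HomFinite.shift_left {A B : C} (h : HomFinite A B) (a : ℤ) : HomFinite (A⟦a⟧) B where
  finiteDimensional n :=
    have := h.finiteDimensional (n + -a)
    LinearEquiv.finiteDimensional (homShiftLeftEquiv A B a (n + -a) n (by ring))
  finite_support := by
    rw [homDim_shift_left]
    exact finite_support_comp_add h.finite_support _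

theorem HomFinite.shift_right {A B : C} (h : HomFinite A B) (a : ℤ) : HomFinite A (B⟦a⟧) where
  finiteDimensional n :=
    have := h.finiteDimensional (n + a)
    LinearEquiv.finiteDimensional (homShiftRightEquiv A B a n (n + a) (by ring)).symm
  finite_support := by
    rw [homDim_shift_right]
    exact finite_support_comp_add h.finite_support _

theorem HomFinite.congr {A A' B B' : C} (h : HomFinite A B) (e : A ≅ A') (e' : B ≅ B') :
    HomFinite A' B' where
  finiteDimensional n :=
    have := h.finiteDimensional n
    LinearEquiv.finiteDimensional (Linear.homCongr ℂ e ((shiftFunctor C n).mapIso e'))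
  finite_support := by
    rw [← homDim_congr e e']
    exact h.finite_support

variable [HasZeroObject C] [Pretriangulated C]

theorem exists_of_comp_shift_map_mor₂_eq_zero {T : Triangle C} (hT : T ∈ distTriang C) {P : C}
    (n : ℤ) (x : P ⟶ T.obj₂⟦n⟧) (hx : x ≫ T.mor₂⟦n⟧' = 0) :
    ∃ y : P ⟶ T.obj₁⟦n⟧, y ≫ T.mor₁⟦n⟧' = x := by
  obtain ⟨y, hy⟩ : ∃ y : P ⟶ T.obj₁⟦n⟧, x = y ≫ (n.negOnePow • T.mor₁⟦n⟧') :=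
    Triangle.coyoneda_exact₂ _ (Triangle.shift_distinguished T hT n) x (by
      change x ≫ (n.negOnePow • T.mor₂⟦n⟧') = 0
      rw [Linear.comp_units_smul, hx, smul_zero])
  -- The morphisms of the triangle shifted by `n` carry the sign `(-1)^n`, which is absorbed into
  -- the lift.
  exact ⟨n.negOnePow • y, by rw [hy, Linear.units_smul_comp, Linear.comp_units_smul]⟩

theorem coyoneda_shift_exact₂ {T : Triangle C} (hT : T ∈ distTriang C) (P : C) (n : ℤ) :
    Function.Exact (Linear.rightComp ℂ P (T.mor₁⟦n⟧')) (Linear.rightComp ℂ P (T.mor₂⟦n⟧')) := by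
  intro x
  constructor
  · exact exists_of_comp_shift_map_mor₂_eq_zero hT n x
  · rintro ⟨y, rfl⟩
    simp [← Functor.map_comp, comp_distTriang_mor_zero₁₂ T hT]

/-- The connecting map `Hom(P, T₃[n]) → Hom(P, T₁[n + 1])`. -/
def coyonedaConnecting (T : Triangle C) (P : C) (n : ℤ) :
    (P ⟶ T.obj₃⟦n⟧) →ₗ[ℂ] (P ⟶ T.obj₁⟦n + 1⟧) :=
  Linear.rightComp ℂ P (T.mor₃⟦n⟧' ≫ (shiftFunctorAdd' C 1 n (n + 1) (by ring)).inv.app T.obj₁)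

theorem coyoneda_shift_exact₃ {T : Triangle C} (hT : T ∈ distTriang C) (P : C) (n : ℤ) :
    Function.Exact (Linear.rightComp ℂ P (T.mor₂⟦n⟧')) (coyonedaConnecting T P n) := by
  intro x
  constructor
  · intro hx
    have hx' : x ≫ T.mor₃⟦n⟧' = 0 := by
      rw [← cancel_mono ((shiftFunctorAdd' C 1 n (n + 1) (by ring)).inv.app T.obj₁)]
      simpa [coyonedaConnecting] using hx
    exact exists_of_comp_shift_map_mor₂_eq_zero (rot_of_distTriang T hT) n x hx'
  · rintro ⟨y, rfl⟩
    simp [coyonedaConnecting, ← Functor.map_comp_assoc, comp_distTriang_mor_zero₂₃ T hT]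

theorem coyoneda_shift_exact₁ {T : Triangle C} (hT : T ∈ distTriang C) (P : C) (n : ℤ) :
    Function.Exact (coyonedaConnecting T P n) (Linear.rightComp ℂ P (T.mor₁⟦n + 1⟧')) := by
  let e := shiftFunctorAdd' C 1 n (n + 1) (by ring)
  have nat : e.inv.app T.obj₁ ≫ T.mor₁⟦n + 1⟧' = T.mor₁⟦(1 : ℤ)⟧'⟦n⟧' ≫ e.inv.app T.obj₂ :=
    (e.inv.naturality T.mor₁).symm
  intro x
  constructor
  · intro hx
    replace hx : x ≫ T.mor₁⟦n + 1⟧' = 0 := hx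
    obtain ⟨y, hy⟩ : ∃ y : P ⟶ T.obj₃⟦n⟧, y ≫ T.mor₃⟦n⟧' = x ≫ e.hom.app T.obj₁ :=
      exists_of_comp_shift_map_mor₂_eq_zero (rot_of_distTriang _ (rot_of_distTriang T hT)) n
        (x ≫ e.hom.app T.obj₁) (by
      change (x ≫ e.hom.app T.obj₁) ≫ (-T.mor₁⟦(1 : ℤ)⟧')⟦n⟧' = 0
      have nat' : e.hom.app T.obj₁ ≫ T.mor₁⟦(1 : ℤ)⟧'⟦n⟧' = T.mor₁⟦n + 1⟧' ≫ e.hom.app T.obj₂ :=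
        (e.hom.naturality T.mor₁).symm
      rw [Functor.map_neg, Preadditive.comp_neg, Category.assoc, nat', reassoc_of% hx, zero_comp,
        neg_zero])
    refine ⟨y, ?_⟩
    change y ≫ T.mor₃⟦n⟧' ≫ e.inv.app T.obj₁ = x
    rw [reassoc_of% hy, Iso.hom_inv_id_app]
    exact Category.comp_id x
  · rintro ⟨y, rfl⟩
    have z : T.mor₃⟦n⟧' ≫ T.mor₁⟦(1 : ℤ)⟧'⟦n⟧' = 0 := by
      rw [← Functor.map_comp, comp_distTriang_mor_zero₃₁ T hT, Functor.map_zero]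
    change (y ≫ T.mor₃⟦n⟧' ≫ e.inv.app T.obj₁) ≫ T.mor₁⟦n + 1⟧' = 0
    rw [Category.assoc, Category.assoc, nat, reassoc_of% z, zero_comp, comp_zero]

theorem yoneda_shift_exact₂ {T : Triangle C} (hT : T ∈ distTriang C) (B : C) (n : ℤ) :
    Function.Exact (Linear.leftComp ℂ (B⟦n⟧) T.mor₂) (Linear.leftComp ℂ (B⟦n⟧) T.mor₁) := by
  intro x
  constructor
  · intro hx
    obtain ⟨y, hy⟩ := Triangle.yoneda_exact₂ T hT x hx
    exact ⟨y, hy.symm⟩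
  · rintro ⟨y, rfl⟩
    simp [comp_distTriang_mor_zero₁₂_assoc T hT]

/-- The connecting map `Hom(T₁, B[n]) → Hom(T₃, B[n + 1])`. -/
def yonedaConnecting (T : Triangle C) (B : C) (n : ℤ) :
    (T.obj₁ ⟶ B⟦n⟧) →ₗ[ℂ] (T.obj₃ ⟶ B⟦n + 1⟧) :=
  Linear.leftComp ℂ _ T.mor₃ ∘ₗ (homShiftLeftEquiv T.obj₁ B 1 n (n + 1) rfl).toLinearMap

theorem yoneda_shift_exact₃ {T : Triangle C} (hT : T ∈ distTriang C) (B : C) (n : ℤ) :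
    Function.Exact (yonedaConnecting T B n) (Linear.leftComp ℂ (B⟦n + 1⟧) T.mor₂) := by
  intro x
  constructor
  · intro hx
    obtain ⟨y, hy⟩ := Triangle.yoneda_exact₃ T hT x hx
    exact ⟨(homShiftLeftEquiv T.obj₁ B 1 n (n + 1) rfl).symm y, by
      simp [yonedaConnecting, hy]⟩
  · rintro ⟨y, rfl⟩
    simp [yonedaConnecting, comp_distTriang_mor_zero₂₃_assoc T hT]

theorem yoneda_shift_exact₁ {T : Triangle C} (hT : T ∈ distTriang C) (B : C) (n : ℤ) :
    Function.Exact (Linear.leftComp ℂ (B⟦n⟧) T.mor₁) (yonedaConnecting T B n) := by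
  have key : ∀ y : T.obj₂ ⟶ B⟦n⟧, homShiftLeftEquiv T.obj₁ B 1 n (n + 1) rfl (T.mor₁ ≫ y) =
      T.mor₁⟦(1 : ℤ)⟧' ≫ homShiftLeftEquiv T.obj₂ B 1 n (n + 1) rfl y := fun y => by
    rw [homShiftLeftEquiv_apply, homShiftLeftEquiv_apply, Functor.map_comp, Category.assoc]
  intro x
  constructor
  · intro hx
    obtain ⟨y, hy⟩ : ∃ y : T.obj₂⟦(1 : ℤ)⟧ ⟶ B⟦n + 1⟧,
        homShiftLeftEquiv T.obj₁ B 1 n (n + 1) rfl x = (-T.mor₁⟦(1 : ℤ)⟧') ≫ y :=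
      Triangle.yoneda_exact₃ _ (rot_of_distTriang T hT)
        (homShiftLeftEquiv T.obj₁ B 1 n (n + 1) rfl x) hx
    refine ⟨-(homShiftLeftEquiv T.obj₂ B 1 n (n + 1) rfl).symm y, ?_⟩
    apply (homShiftLeftEquiv T.obj₁ B 1 n (n + 1) rfl).injective
    rw [hy, Linear.leftComp_apply, key, map_neg, LinearEquiv.apply_symm_apply]
    exact (Preadditive.comp_neg _ _).trans (Preadditive.neg_comp _ _).symm
  · rintro ⟨y, rfl⟩
    simp [yonedaConnecting, key, comp_distTriang_mor_zero₃₁_assoc T hT]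

theorem homFinite_and_eulerForm_of_triangle_right {T : Triangle C} (hT : T ∈ distTriang C) (P : C)
    (h₁ : HomFinite P T.obj₁) (h₃ : HomFinite P T.obj₃) :
    HomFinite P T.obj₂ ∧ eulerForm P T.obj₂ = eulerForm P T.obj₁ + eulerForm P T.obj₃ := by
  have := h₁.finiteDimensional
  have := h₃.finiteDimensional
  have := finite_support_and_alternatingSum_of_exact _ _ _ _ _ _
    (coyoneda_shift_exact₂ hT P) (coyoneda_shift_exact₃ hT P) (coyoneda_shift_exact₁ hT P)
    h₁.finite_support h₃.finite_support
  exact ⟨⟨fun n => finiteDimensional_of_exact _ _ (coyoneda_shift_exact₂ hT P n), this.1⟩, this.2⟩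

theorem homFinite_and_eulerForm_of_triangle_left {T : Triangle C} (hT : T ∈ distTriang C) (B : C)
    (h₁ : HomFinite T.obj₁ B) (h₃ : HomFinite T.obj₃ B) :
    HomFinite T.obj₂ B ∧ eulerForm T.obj₂ B = eulerForm T.obj₁ B + eulerForm T.obj₃ B := by
  have := h₁.finiteDimensional
  have := h₃.finiteDimensional
  -- By contravariance the long exact sequence runs from `T.obj₃` through `T.obj₂` to `T.obj₁`, so
  -- the outer terms trade places.
  have := finite_support_and_alternatingSum_of_exact _ _ _ _ _ _
    (yoneda_shift_exact₂ hT B) (yoneda_shift_exact₁ hT B) (yoneda_shift_exact₃ hT B)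
    h₃.finite_support h₁.finite_support
  exact ⟨⟨fun n => finiteDimensional_of_exact _ _ (yoneda_shift_exact₂ hT B n), this.1⟩,
    this.2.trans (add_comm _ _)⟩

end EulerForm

/-! ### Generators and the Grothendieck group -/

section Generators

open CategoryTheory.Pretriangulated

set_option linter.unusedSectionVars false

universe v u

variable {C : Type u} [Category.{v} C] [Preadditive C] [HasShift C ℤ] [Linear ℂ C]
  [∀ n : ℤ, (shiftFunctor C n).Additive] [∀ n : ℤ, (shiftFunctor C n).Linear ℂ]
  [HasZeroObject C] [Pretriangulated C]

/-- Every object is obtained from the objects `P i` by isomorphisms, shifts and extensions. -/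
def Generates {ι : Type*} (P : ι → C) : Prop :=
  ∀ Q : C → Prop, (∀ ⦃X Y⦄, (X ≅ Y) → Q X → Q Y) → (∀ X (n : ℤ), Q X → Q (X⟦n⟧)) →
    (∀ T ∈ distTriang C, Q T.obj₁ → Q T.obj₃ → Q T.obj₂) → (∀ i, Q (P i)) → ∀ X, Q X

variable {ι : Type*} {P : ι → C}

theorem Generates.homFinite (h : Generates P) (hP : ∀ i j, HomFinite (P i) (P j)) (A B : C) :
    HomFinite A B := by
  have h₁ : ∀ i B, HomFinite (P i) B := fun i => h (fun B => HomFinite (P i) B)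
    (fun X Y e hX => hX.congr (Iso.refl _) e) (fun X n hX => hX.shift_right n)
    (fun T hT h₁ h₃ => (homFinite_and_eulerForm_of_triangle_right hT (P i) h₁ h₃).1) (hP i)
  exact h (fun A => HomFinite A B) (fun X Y e hX => hX.congr e (Iso.refl _))
    (fun X n hX => hX.shift_left n)
    (fun T hT h₁ h₃ => (homFinite_and_eulerForm_of_triangle_left hT B h₁ h₃).1) (h₁ · B) A

/-- Every object has a class in the free abelian group on the generators that computes its
Euler forms. -/
theorem Generates.exists_class [Fintype ι] (h : Generates P)
    (hP : ∀ i j, HomFinite (P i) (P j)) (A : C) :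
    ∃ x : ι → ℤ, (∀ B, eulerForm A B = ∑ i, x i * eulerForm (P i) B) ∧
      ∀ B, eulerForm B A = ∑ i, x i * eulerForm B (P i) := by
  classical
  refine h (fun A => ∃ x : ι → ℤ, (∀ B, eulerForm A B = ∑ i, x i * eulerForm (P i) B) ∧
      ∀ B, eulerForm B A = ∑ i, x i * eulerForm B (P i)) ?_ ?_ ?_ ?_ A
  · rintro X Y e ⟨x, h₁, h₂⟩
    exact ⟨x, fun B => by rw [← h₁, eulerForm, eulerForm, homDim_congr e (Iso.refl B)],
      fun B => by rw [← h₂, eulerForm, eulerForm, homDim_congr (Iso.refl B) e]⟩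
  · rintro X n ⟨x, h₁, h₂⟩
    refine ⟨fun i => n.negOnePow * x i, fun B => ?_, fun B => ?_⟩
    · rw [eulerForm_shift_left, h₁, Finset.mul_sum]
      simp only [mul_assoc]
    · rw [eulerForm_shift_right, h₂, Finset.mul_sum]
      simp only [mul_assoc]
  · rintro T hT ⟨x, h₁, h₂⟩ ⟨y, h₁', h₂'⟩
    have fin := h.homFinite hP
    refine ⟨x + y, fun B => ?_, fun B => ?_⟩
    · rw [(homFinite_and_eulerForm_of_triangle_left hT B (fin _ _) (fin _ _)).2, h₁, h₁',
        ← Finset.sum_add_distrib]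
      simp [add_mul]
    · rw [(homFinite_and_eulerForm_of_triangle_right hT B (fin _ _) (fin _ _)).2, h₂, h₂',
        ← Finset.sum_add_distrib]
      simp [add_mul]
  · intro i
    exact ⟨Pi.single i 1, fun B => by simp [Pi.single_apply], fun B => by simp [Pi.single_apply]⟩

/-- The objects with no nonzero map to any shift of `A` are closed under shifts and extensions. Once
they contain the generators they contain `A`, whose identity is then zero. -/
theorem Generates.isZero (h : Generates P) (A : C)
    (hA : ∀ i (n : ℤ), Subsingleton (P i ⟶ A⟦n⟧)) : IsZero A := by
  have key : ∀ X, ∀ n : ℤ, ∀ f : X ⟶ A⟦n⟧, f = 0 := h (fun X => ∀ n : ℤ, ∀ f : X ⟶ A⟦n⟧, f = 0)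
    (fun X Y e hX n f => by rw [← cancel_epi e.hom, hX n (e.hom ≫ f), comp_zero])
    (fun X a hX n f => by
      have := (homShiftLeftEquiv X A a (n + -a) n (by ring)).symm.injective
      exact this ((hX (n + -a) _).trans (map_zero _).symm))
    (fun T hT h₁ h₃ n f => by
      obtain ⟨g, rfl⟩ := Triangle.yoneda_exact₂ T hT f (h₁ n _)
      rw [h₃ n g, comp_zero])
    (fun i n f => (hA i n).elim _ _)
  rw [IsZero.iff_id_eq_zero, ← cancel_mono ((shiftFunctorZero C ℤ).inv.app A)]
  exact (key A 0 _).trans (key A 0 _).symm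

end Generators

/-! ### Dimensions of morphism spaces in the orbit category -/

theorem finsum_eq_finsum_even_add_finsum_odd {M : Type*} [AddCommMonoid M] (f : ℤ → M)
    (hf : (Function.support f).Finite) :
    ∑ᶠ n, f n = ∑ᶠ k : ℤ, f (2 * k) + ∑ᶠ k : ℤ, f (2 * k + 1) := by
  have i₀ : Function.Injective fun k : ℤ => 2 * k := fun a b h => by simpa using h
  have i₁ : Function.Injective fun k : ℤ => 2 * k + 1 := fun a b h => by simpa using h
  rw [← finsum_mem_range (f := f) i₀, ← finsum_mem_range (f := f) i₁,
    ← finsum_mem_union' (f := f) ?_ (hf.inter_of_right _) (hf.inter_of_right _)]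
  · rw [← finsum_mem_univ]
    refine finsum_congr fun n => ?_
    have hn : n ∈ (Set.range fun k : ℤ => 2 * k) ∪ Set.range fun k : ℤ => 2 * k + 1 := by
      rcases Int.even_or_odd' n with ⟨k, rfl | rfl⟩
      · exact Or.inl ⟨k, rfl⟩
      · exact Or.inr ⟨k, rfl⟩
    simp only [Set.mem_univ, hn]
  · rw [Set.disjoint_left]
    rintro _ ⟨a, rfl⟩ ⟨b, hb⟩
    simp only at hb
    lia

theorem alternatingSum_eq_sub {d : ℤ → ℕ} (hd : (Function.support d).Finite) :
    alternatingSum d = ((∑ᶠ k : ℤ, d (2 * k) : ℕ) : ℤ) - (∑ᶠ k : ℤ, d (2 * k + 1) : ℕ) := by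
  have fin (a : ℤ) : (Function.support fun k : ℤ => d (2 * k + a)).Finite :=
    Set.Finite.preimage (f := fun k : ℤ => 2 * k + a)
      (fun a _ b _ h => by simpa using h) hd
  unfold alternatingSum
  rw [finsum_eq_finsum_even_add_finsum_odd _ (hd.subset fun n hn => by
    simp only [Function.mem_support] at hn ⊢
    rintro h; simp [h] at hn)]
  have cast (a : ℤ) : ((∑ᶠ k : ℤ, d (2 * k + a) : ℕ) : ℤ) = ∑ᶠ k : ℤ, (d (2 * k + a) : ℤ) :=
    (Nat.castAddMonoidHom ℤ).map_finsum (fin a)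
  have cast₀ := cast 0
  simp only [add_zero] at cast₀
  rw [cast₀, cast, sub_eq_add_neg, ← finsum_neg_distrib]
  congr 1 <;> refine finsum_congr fun k => ?_
  · simp [Int.negOnePow_even]
  · rw [Int.negOnePow_odd _ ⟨k, rfl⟩]
    simp

theorem rank_directSum_of_finite_support (K : Type*) [Field K] (V : ℤ → Type*)
    [∀ n, AddCommGroup (V n)] [∀ n, Module K (V n)] [∀ n, FiniteDimensional K (V n)]
    (h : (Function.support fun n => Module.finrank K (V n)).Finite) :
    Module.rank K (DirectSum ℤ V) = ((∑ᶠ n, Module.finrank K (V n) : ℕ) : Cardinal) := by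
  classical
  let s := h.toFinset
  have hs : ∀ n ∉ s, Subsingleton (V n) := fun n hn => by
    rw [← Module.finrank_zero_iff (R := K)]
    simpa [s] using hn
  let φ : DirectSum ℤ V →ₗ[K] (∀ n : s, V n) := LinearMap.pi fun n => DirectSum.component K ℤ V n
  have hφ : Function.Bijective φ := by
    constructor
    · intro x y hxy
      refine DFinsupp.ext fun n => ?_
      by_cases hn : n ∈ s
      · exact congrFun hxy ⟨n, hn⟩
      · exact (hs n hn).elim _ _
    · intro y
      refine ⟨DFinsupp.mk s y, funext fun n => ?_⟩
      exact DFinsupp.mk_of_mem n.2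
  rw [(LinearEquiv.ofBijective φ hφ).rank_eq, ← Module.finrank_eq_rank,
    Module.finrank_pi_fintype, finsum_eq_sum_of_support_subset _ (s := s) (by simp [s])]
  congr 1
  exact Finset.sum_coe_sort s fun n => Module.finrank K (V n)

section OrbitHom

universe v u

set_option linter.unusedSectionVars false

variable {C : Type u} [Category.{v} C] [Preadditive C] [HasShift C ℤ] [Linear ℂ C]
  [∀ n : ℤ, (shiftFunctor C n).Additive] [∀ n : ℤ, (shiftFunctor C n).Linear ℂ]

theorem HomFinite.rank_orbitHom {A B : C} (h : HomFinite A B) :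
    Module.rank ℂ (OrbitHom A B) = ((∑ᶠ k : ℤ, homDim A B (2 * k) : ℕ) : Cardinal) :=
  have := fun k : ℤ => h.finiteDimensional (2 * k)
  rank_directSum_of_finite_support ℂ _
    (Set.Finite.preimage (f := fun k : ℤ => 2 * k) (fun a _ b _ h => by simpa using h)
      h.finite_support)

theorem HomFinite.finrank_orbitHom {A B : C} (h : HomFinite A B) :
    Module.finrank ℂ (OrbitHom A B) = ∑ᶠ k : ℤ, homDim A B (2 * k) :=
  Module.finrank_eq_of_rank_eq h.rank_orbitHom

theorem HomFinite.rank_orbitHom_add {A B : C} (h : HomFinite A B) :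
    Module.rank ℂ (OrbitHom A B) + Module.rank ℂ (OrbitHom A (B⟦(1 : ℤ)⟧)) =
      ((∑ᶠ n : ℤ, homDim A B n : ℕ) : Cardinal) := by
  rw [h.rank_orbitHom, (h.shift_right 1).rank_orbitHom,
    finsum_eq_finsum_even_add_finsum_odd _ h.finite_support, homDim_shift_right]
  push_cast
  rfl

/-- The odd part is expressed by shifting the first argument, so that `B` enters only through orbit
morphisms into it. The Euler form is then visibly invariant under isomorphisms of `B` in the orbit
category. -/
theorem HomFinite.eulerForm_eq_finrank_sub {A B : C} (h : HomFinite A B) :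
    eulerForm A B = (Module.finrank ℂ (OrbitHom A B) : ℤ) -
      Module.finrank ℂ (OrbitHom (A⟦(1 : ℤ)⟧) B) := by
  rw [h.finrank_orbitHom, (h.shift_left 1).finrank_orbitHom, eulerForm,
    alternatingSum_eq_sub h.finite_support, homDim_shift_left]
  congr 2
  rw [← finsum_comp_equiv (Equiv.addRight (-1 : ℤ))]
  refine finsum_congr fun k => congrArg _ ?_
  simp only [Equiv.coe_addRight]
  ring

end OrbitHom

/-! ### The Coxeter transformation of type `E_r` -/

/-- The vertex of number `i` is reached from the vertex of number `j` by a path in the quiver of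
type `E_r`. -/
def EReach (r j i : ℕ) : Prop :=
  j = i ∨ i = r ∨ (j = 1 ∧ i = 2) ∨ (3 ≤ j ∧ j ≤ i ∧ i + 2 ≤ r)

instance (r j i : ℕ) : Decidable (EReach r j i) := by unfold EReach; infer_instance

/-- The matrix with entries the Euler forms of the indecomposable projectives. -/
def eCartan (r : ℕ) (i j : Fin r) : ℤ := if EReach r (j + 1) (i + 1) then 1 else 0

/-- The bilinear form with matrix `eCartan r`. -/
def eForm (r : ℕ) (x y : Fin r → ℤ) : ℤ := ∑ i, ∑ j, x i * eCartan r i j * y j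

/-- `y'` is the image of `y` under the Coxeter transformation: `⟨z, y'⟩ = -⟨y, z⟩` for all `z`. -/
def IsCoxeterImage (r : ℕ) (y y' : Fin r → ℤ) : Prop :=
  ∀ i, ∑ j, eCartan r i j * y' j = -∑ j, y j * eCartan r j i

/-! ### The Coxeter transformation in coordinates and its characteristic polynomial. -/

theorem eForm_six (x y : Fin 6 → ℤ) : eForm 6 x y =
    x 0 * y 0 + x 1 * (y 0 + y 1) + x 2 * y 2 + x 3 * (y 2 + y 3) + x 4 * y 4 +
      x 5 * (y 0 + y 1 + y 2 + y 3 + y 4 + y 5) := by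
  simp [eForm, eCartan, EReach, Fin.sum_univ_succ]
  ring

theorem IsCoxeterImage.six {y y' : Fin 6 → ℤ} (h : IsCoxeterImage 6 y y') :
    y' 0 = -(y 0 + y 1 + y 5) ∧ y' 1 = y 0 ∧ y' 2 = -(y 2 + y 3 + y 5) ∧ y' 3 = y 2 ∧
      y' 4 = -(y 4 + y 5) ∧ y' 5 = y 1 + y 3 + y 4 + 2 * y 5 := by
  have h0 := h 0
  have h1 := h 1
  have h2 := h 2
  have h3 := h 3
  have h4 := h 4
  have h5 := h 5
  simp [eCartan, EReach, Fin.sum_univ_succ] at h0 h1 h2 h3 h4 h5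
  omega

/-- This is Cayley–Hamilton for the Coxeter polynomial `x^6 + x^5 - x^3 + x + 1`, the product of the
cyclotomic polynomials of orders 3 and 12. For `E_7` the orders are 2 and 18, and for `E_8` the
polynomial is the cyclotomic polynomial of order 30. -/
theorem charpoly_six {y : ℕ → Fin 6 → ℤ} (h : ∀ k, IsCoxeterImage 6 (y k) (y (k + 1)))
    (i : Fin 6) : y 6 i + y 5 i - y 3 i + y 1 i + y 0 i = 0 := by
  have h0 := (h 0).six
  have h1 := (h 1).six
  have h2 := (h 2).six
  have h3 := (h 3).six
  have h4 := (h 4).six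
  have h5 := (h 5).six
  simp only [Nat.reduceAdd] at *
  fin_cases i <;> simp <;> omega

theorem eForm_seven (x y : Fin 7 → ℤ) : eForm 7 x y =
    x 0 * y 0 + x 1 * (y 0 + y 1) + x 2 * y 2 + x 3 * (y 2 + y 3) + x 4 * (y 2 + y 3 + y 4) +
      x 5 * y 5 + x 6 * (y 0 + y 1 + y 2 + y 3 + y 4 + y 5 + y 6) := by
  simp [eForm, eCartan, EReach, Fin.sum_univ_succ]
  ring

theorem IsCoxeterImage.seven {y y' : Fin 7 → ℤ} (h : IsCoxeterImage 7 y y') :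
    y' 0 = -(y 0 + y 1 + y 6) ∧ y' 1 = y 0 ∧ y' 2 = -(y 2 + y 3 + y 4 + y 6) ∧ y' 3 = y 2 ∧
      y' 4 = y 3 ∧ y' 5 = -(y 5 + y 6) ∧ y' 6 = y 1 + y 4 + y 5 + 2 * y 6 := by
  have h0 := h 0
  have h1 := h 1
  have h2 := h 2
  have h3 := h 3
  have h4 := h 4
  have h5 := h 5
  have h6 := h 6
  simp [eCartan, EReach, Fin.sum_univ_succ] at h0 h1 h2 h3 h4 h5 h6
  omega

theorem charpoly_seven {y : ℕ → Fin 7 → ℤ} (h : ∀ k, IsCoxeterImage 7 (y k) (y (k + 1)))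
    (i : Fin 7) : y 7 i + y 6 i - y 4 i - y 3 i + y 1 i + y 0 i = 0 := by
  have h0 := (h 0).seven
  have h1 := (h 1).seven
  have h2 := (h 2).seven
  have h3 := (h 3).seven
  have h4 := (h 4).seven
  have h5 := (h 5).seven
  have h6 := (h 6).seven
  simp only [Nat.reduceAdd] at *
  fin_cases i <;> simp <;> omega

theorem IsCoxeterImage.eight {y y' : Fin 8 → ℤ} (h : IsCoxeterImage 8 y y') :
    y' 0 = -(y 0 + y 1 + y 7) ∧ y' 1 = y 0 ∧ y' 2 = -(y 2 + y 3 + y 4 + y 5 + y 7) ∧ y' 3 = y 2 ∧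
      y' 4 = y 3 ∧ y' 5 = y 4 ∧ y' 6 = -(y 6 + y 7) ∧ y' 7 = y 1 + y 5 + y 6 + 2 * y 7 := by
  have h0 := h 0
  have h1 := h 1
  have h2 := h 2
  have h3 := h 3
  have h4 := h 4
  have h5 := h 5
  have h6 := h 6
  have h7 := h 7
  simp [eCartan, EReach, Fin.sum_univ_succ] at h0 h1 h2 h3 h4 h5 h6 h7
  omega

theorem charpoly_eight {y : ℕ → Fin 8 → ℤ} (h : ∀ k, IsCoxeterImage 8 (y k) (y (k + 1)))
    (i : Fin 8) : y 8 i + y 7 i - y 5 i - y 4 i - y 3 i + y 1 i + y 0 i = 0 := by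
  have h0 := (h 0).eight
  have h1 := (h 1).eight
  have h2 := (h 2).eight
  have h3 := (h 3).eight
  have h4 := (h 4).eight
  have h5 := (h 5).eight
  have h6 := (h 6).eight
  have h7 := (h 7).eight
  simp only [Nat.reduceAdd] at *
  fin_cases i <;> simp <;> omega

theorem IsCoxeterImage.unique {r : ℕ} (hr : r = 6 ∨ r = 7 ∨ r = 8) {y y' y'' : Fin r → ℤ}
    (h : IsCoxeterImage r y y') (h' : IsCoxeterImage r y y'') : y' = y'' := by
  rcases hr with rfl | rfl | rfl
  · have := h.six
    have := h'.six
    ext i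
    fin_cases i <;> simp <;> omega
  · have := h.seven
    have := h'.seven
    ext i
    fin_cases i <;> simp <;> omega
  · have := h.eight
    have := h'.eight
    ext i
    fin_cases i <;> simp <;> omega

theorem IsCoxeterImage.smul {r : ℕ} {y y' : Fin r → ℤ} (h : IsCoxeterImage r y y') (s : ℤ) :
    IsCoxeterImage r (s • y) (s • y') := fun i => by
  have := congrArg (s * ·) (h i)
  simp only [mul_neg, Finset.mul_sum] at this
  simp only [Pi.smul_apply, smul_eq_mul]
  calc ∑ j, eCartan r i j * (s * y' j) = ∑ j, s * (eCartan r i j * y' j) :=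
        Finset.sum_congr rfl fun j _ => by ring
    _ = -∑ j, s * (y j * eCartan r j i) := this
    _ = -∑ j, s * y j * eCartan r j i :=
        congrArg _ (Finset.sum_congr rfl fun j _ => by ring)

/-! ### Periodic vectors of the Coxeter transformation and the values of the form on them. -/

theorem coxeter_periodic {r : ℕ} (hr : r = 6 ∨ r = 7 ∨ r = 8) {y : ℕ → Fin r → ℤ}
    (h : ∀ k, IsCoxeterImage r (y k) (y (k + 1))) {p : ℕ} {s : ℤ} (hp : y p = s • y 0) (k : ℕ) :
    y (k + p) = s • y k := by
  induction k with
  | zero => rw [zero_add, hp]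
  | succ k ih =>
    refine IsCoxeterImage.unique hr (y := y (k + p)) ?_ (ih ▸ (h k).smul s)
    rw [show k + 1 + p = k + p + 1 by ring]
    exact h _

theorem eForm_eq_sum {r : ℕ} (x : Fin r → ℤ) :
    ∃ w : Fin r → ℤ, ∀ y, eForm r x y = ∑ j, w j * y j := by
  refine ⟨fun j => ∑ i, x i * eCartan r i j, fun y => ?_⟩
  rw [eForm, Finset.sum_comm]
  exact Finset.sum_congr rfl fun j _ => (Finset.sum_mul ..).symm

theorem IsCoxeterImage.eForm_eq_neg {r : ℕ} {y y' : Fin r → ℤ} (h : IsCoxeterImage r y y')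
    (x : Fin r → ℤ) : eForm r x y' = -eForm r y x := by
  have : ∀ i, ∑ j, x i * eCartan r i j * y' j = -∑ j, y j * eCartan r j i * x i := fun i => by
    simp only [mul_assoc, ← Finset.mul_sum]
    rw [h i, mul_neg, Finset.mul_sum]
    congr 1
    exact Finset.sum_congr rfl fun j _ => by ring
  rw [eForm, eForm, Finset.sum_comm (γ := Fin r) (f := fun i j => y i * eCartan r i j * x j)]
  simp only [this, Finset.sum_neg_distrib]

/-- This settles the class of `A` when `p = 1`. The number 1 is never an eigenvalue of the Coxeter
transformation, and -1 is one only for `E_7`, where the eigenvectors are the multiples of `(0, 0, 1,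
-1, 1, -1, 0)`, on which the form is 3 times a square. -/
theorem eForm_self_ne_of_coxeter_fixed {r : ℕ} (hr : r = 6 ∨ r = 7 ∨ r = 8) {y y' : Fin r → ℤ}
    (h : IsCoxeterImage r y y') {s : ℤ} (hs : s = 1 ∨ s = -1) (hy : y' = s • y) :
    eForm r y y ≠ 2 ∧ (eForm r y y = 0 → y = 0) := by
  rcases hr with rfl | rfl | rfl
  · have hc := h.six
    subst hy
    have : y = 0 := by
      ext i
      rcases hs with rfl | rfl <;> simp at hc <;> fin_cases i <;> simp <;> omega
    subst this
    simp [eForm]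
  · have hc := h.seven
    subst hy
    have key : y 0 = 0 ∧ y 1 = 0 ∧ y 3 = -y 2 ∧ y 4 = y 2 ∧ y 5 = -y 2 ∧ y 6 = 0 := by
      rcases hs with rfl | rfl <;> simp at hc <;> omega
    obtain ⟨k0, k1, k3, k4, k5, k6⟩ := key
    have hq : eForm 7 y y = 3 * (y 2 * y 2) := by
      rw [eForm_seven, k0, k1, k3, k4, k5, k6]
      ring
    rw [hq]
    refine ⟨by omega, fun h0 => ?_⟩
    have k2 : y 2 = 0 := by simpa using h0
    ext i
    fin_cases i <;> simp <;> omega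
  · have hc := h.eight
    subst hy
    have : y = 0 := by
      ext i
      rcases hs with rfl | rfl <;> simp at hc <;> fin_cases i <;> simp <;> omega
    subst this
    simp [eForm]

/-- The exception comes from the factor `x^2 + x + 1` of the Coxeter polynomial, whose recurrence is
satisfied by the sequence `1, -1, 0` repeated. -/
theorem scalar_recurrence_six {g : ℕ → ℤ}
    (hrec : ∀ k, g (k + 6) + g (k + 5) - g (k + 3) + g (k + 1) + g k = 0) {p : ℕ} (hp : 2 ≤ p)
    {s : ℤ} (hs : s = 1 ∨ s = -1) (hper : ∀ k, g (k + p) = s * g k) (g0 : g 0 = 1) (g1 : g 1 = -1)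
    (gk : ∀ k, 2 ≤ k → k < p → g k = 0) : p = 3 ∧ s = 1 := by
  -- From 8 = 6 + 2 on, all of `g 2, …, g 7` vanish, and the recurrence at `k = 1` reduces to `g 1 =
  -- 0`. Only finitely many periods remain, each a linear problem.
  by_cases hp8 : 8 ≤ p
  · have := hrec 1
    simp only [Nat.reduceAdd] at this
    rw [gk 7 (by omega) (by omega), gk 6 (by omega) (by omega), gk 4 (by omega) (by omega),
      gk 2 (by omega) (by omega), g1] at this
    omega
  · have r0 := hrec 0
    have r1 := hrec 1
    have r2 := hrec 2
    have r3 := hrec 3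
    have p0 := hper 0
    have p1 := hper 1
    have p2 := hper 2
    have p3 := hper 3
    have p4 := hper 4
    have p5 := hper 5
    have p6 := hper 6
    have g2 := gk 2 (by omega)
    have g3 := gk 3 (by omega)
    have g4 := gk 4 (by omega)
    have g5 := gk 5 (by omega)
    have g6 := gk 6 (by omega)
    clear hrec hper gk
    rcases hs with rfl | rfl <;> interval_cases p <;>
      simp only [Nat.reduceAdd, zero_add, and_true, and_self] at * <;> omega

/-- The exception is the sequence `(-1)^k`, coming from the factor `x + 1` of the Coxeter
polynomial. -/
theorem scalar_recurrence_seven {g : ℕ → ℤ}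
    (hrec : ∀ k, g (k + 7) + g (k + 6) - g (k + 4) - g (k + 3) + g (k + 1) + g k = 0) {p : ℕ}
    (hp : 2 ≤ p) {s : ℤ} (hs : s = 1 ∨ s = -1) (hper : ∀ k, g (k + p) = s * g k) (g0 : g 0 = 1)
    (g1 : g 1 = -1) (gk : ∀ k, 2 ≤ k → k < p → g k = 0) : p = 2 ∧ s = 1 := by
  by_cases hp9 : 9 ≤ p
  · have := hrec 1
    simp only [Nat.reduceAdd] at this
    rw [gk 8 (by omega) (by omega), gk 7 (by omega) (by omega), gk 5 (by omega) (by omega),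
      gk 4 (by omega) (by omega), gk 2 (by omega) (by omega), g1] at this
    omega
  · have r0 := hrec 0
    have r1 := hrec 1
    have r2 := hrec 2
    have r3 := hrec 3
    have p0 := hper 0
    have p1 := hper 1
    have p2 := hper 2
    have p3 := hper 3
    have p4 := hper 4
    have p5 := hper 5
    have p6 := hper 6
    have p7 := hper 7
    have g2 := gk 2 (by omega)
    have g3 := gk 3 (by omega)
    have g4 := gk 4 (by omega)
    have g5 := gk 5 (by omega)
    have g6 := gk 6 (by omega)
    have g7 := gk 7 (by omega)
    clear hrec hper gk
    rcases hs with rfl | rfl <;> interval_cases p <;>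
      simp only [Nat.reduceAdd, zero_add, and_true, and_self] at * <;> omega

/-- No exception survives: the Coxeter polynomial is irreducible with the primitive 30th roots of
unity as roots, so a nonzero solution with this periodicity needs `p` divisible by 15, and such a
`p` is long enough for the recurrence at `k = 1` to fail. -/
theorem scalar_recurrence_eight {g : ℕ → ℤ}
    (hrec : ∀ k, g (k + 8) + g (k + 7) - g (k + 5) - g (k + 4) - g (k + 3) + g (k + 1) + g k = 0)
    {p : ℕ} (hp : 2 ≤ p) {s : ℤ} (hs : s = 1 ∨ s = -1) (hper : ∀ k, g (k + p) = s * g k)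
    (g0 : g 0 = 1) (g1 : g 1 = -1) (gk : ∀ k, 2 ≤ k → k < p → g k = 0) : False := by
  by_cases hp10 : 10 ≤ p
  · have := hrec 1
    simp only [Nat.reduceAdd] at this
    rw [gk 9 (by omega) (by omega), gk 8 (by omega) (by omega), gk 6 (by omega) (by omega),
      gk 5 (by omega) (by omega), gk 4 (by omega) (by omega), gk 2 (by omega) (by omega),
      g1] at this
    omega
  · have r0 := hrec 0
    have r1 := hrec 1
    have r2 := hrec 2
    have r3 := hrec 3
    have p0 := hper 0
    have p1 := hper 1
    have p2 := hper 2
    have p3 := hper 3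
    have p4 := hper 4
    have p5 := hper 5
    have p6 := hper 6
    have p7 := hper 7
    have p8 := hper 8
    have g2 := gk 2 (by omega)
    have g3 := gk 3 (by omega)
    have g4 := gk 4 (by omega)
    have g5 := gk 5 (by omega)
    have g6 := gk 6 (by omega)
    have g7 := gk 7 (by omega)
    have g8 := gk 8 (by omega)
    clear hrec hper gk
    rcases hs with rfl | rfl <;> interval_cases p <;>
      simp only [Nat.reduceAdd, zero_add] at * <;> omega

theorem not_coxeter_periodic {r : ℕ} (hr : r = 6 ∨ r = 7 ∨ r = 8) {y : ℕ → Fin r → ℤ}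
    (h : ∀ k, IsCoxeterImage r (y k) (y (k + 1))) {p : ℕ} (hp : 2 ≤ p) {s : ℤ}
    (hs : s = 1 ∨ s = -1) (hps : y p = s • y 0) (h0 : eForm r (y 0) (y 0) = 1)
    (hk : ∀ k, 2 ≤ k → k < p → eForm r (y 0) (y k) = 0) : False := by
  obtain ⟨w, hw⟩ := eForm_eq_sum (y 0)
  obtain ⟨g, hg⟩ : ∃ g : ℕ → ℤ, ∀ k, g k = eForm r (y 0) (y k) := ⟨_, fun _ => rfl⟩
  have hper (k : ℕ) : g (k + p) = s * g k := by
    rw [hg, hg, coxeter_periodic hr h hps k, hw, hw, Finset.mul_sum]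
    refine Finset.sum_congr rfl fun i _ => ?_
    rw [Pi.smul_apply, smul_eq_mul]
    ring
  have g0 : g 0 = 1 := (hg 0).trans h0
  have g1 : g 1 = -1 := by rw [hg, (h 0).eForm_eq_neg, h0]
  have gk : ∀ k, 2 ≤ k → k < p → g k = 0 := fun k h2 h3 => (hg k).trans (hk k h2 h3)
  rcases hr with rfl | rfl | rfl
  · obtain ⟨rfl, rfl⟩ := scalar_recurrence_six (fun k => by
      simp only [hg, hw, ← Finset.sum_add_distrib, ← Finset.sum_sub_distrib]
      refine Finset.sum_eq_zero fun i _ => ?_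
      have := charpoly_six (y := fun m => y (k + m)) (fun m => h (k + m)) i
      simp only [add_zero] at this
      linear_combination w i * this) hp hs hper g0 g1 gk
    have c0 := (h 0).six
    have c1 := (h 1).six
    have c2 := (h 2).six
    rw [one_smul] at hps
    simp only [Nat.reduceAdd, hps] at c0 c1 c2
    -- These equations cut out the rank-two lattice of vectors fixed by the cube of the Coxeter
    -- transformation. The form is even there, so it cannot be 1.
    obtain ⟨k2, k3, k4, k5⟩ : y 0 2 = -y 0 0 ∧ y 0 3 = -y 0 1 ∧ y 0 4 = 0 ∧ y 0 5 = 0 := by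
      omega
    have hq : eForm 6 (y 0) (y 0) = 2 * (y 0 0 * y 0 0 + y 0 0 * y 0 1 + y 0 1 * y 0 1) := by
      rw [eForm_six, k2, k3, k4, k5]
      ring
    omega
  · obtain ⟨rfl, rfl⟩ := scalar_recurrence_seven (fun k => by
      simp only [hg, hw, ← Finset.sum_add_distrib, ← Finset.sum_sub_distrib]
      refine Finset.sum_eq_zero fun i _ => ?_
      have := charpoly_seven (y := fun m => y (k + m)) (fun m => h (k + m)) i
      simp only [add_zero] at this
      linear_combination w i * this) hp hs hper g0 g1 gk
    have c0 := (h 0).seven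
    have c1 := (h 1).seven
    rw [one_smul] at hps
    simp only [Nat.reduceAdd, hps] at c0 c1
    -- The vectors fixed by the square form the same line as the eigenvectors for -1, and the form
    -- there is a multiple of 3.
    obtain ⟨k0, k1, k3, k4, k5, k6⟩ : y 0 0 = 0 ∧ y 0 1 = 0 ∧ y 0 3 = -y 0 2 ∧ y 0 4 = y 0 2 ∧
      y 0 5 = -y 0 2 ∧ y 0 6 = 0 := by omega
    have hq : eForm 7 (y 0) (y 0) = 3 * (y 0 2 * y 0 2) := by
      rw [eForm_seven, k0, k1, k3, k4, k5, k6]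
      ring
    omega
  · exact scalar_recurrence_eight (fun k => by
      simp only [hg, hw, ← Finset.sum_add_distrib, ← Finset.sum_sub_distrib]
      refine Finset.sum_eq_zero fun i _ => ?_
      have := charpoly_eight (y := fun m => y (k + m)) (fun m => h (k + m)) i
      simp only [add_zero] at this
      linear_combination w i * this) hp hs hper g0 g1 gk

/-! ### Paths in the quiver of type `E_r` -/

section EPaths

variable {r : ℕ}

theorem EVertex.ext_num {v w : EVertex r} (h : v.num = w.num) : v = w := by
  rcases v with ⟨v⟩
  rcases w with ⟨w⟩
  simp only [EVertex.num, add_left_inj] at h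
  rw [Fin.ext h]

theorem EVertex.num_pos (v : EVertex r) : 1 ≤ v.num := Nat.le_add_left _ _

theorem EVertex.num_le (v : EVertex r) : v.num ≤ r := v.idx.isLt

theorem EVertex.exists_num {n : ℕ} (h₁ : 1 ≤ n) (h₂ : n ≤ r) : ∃ v : EVertex r, v.num = n :=
  ⟨⟨⟨n - 1, by omega⟩⟩, by simp only [EVertex.num]; omega⟩

theorem EReach.of_path (hr : 6 ≤ r) {v w : EVertex r} (p : Quiver.Path v w) :
    EReach r v.num w.num := by
  induction p with
  | nil => exact Or.inl rfl
  | @cons b c _ e ih =>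
    have he : b.IsArrow c := e.down
    have := v.num_pos
    have := b.num_pos
    have := c.num_le
    have := b.num_le
    unfold EVertex.IsArrow at he
    unfold EReach at ih ⊢
    omega

theorem EReach.antisymm {i j : ℕ} (hr : 6 ≤ r) (hj : j ≤ r) (h : EReach r i j)
    (h' : EReach r j i) : i = j := by
  unfold EReach at h h'
  omega

instance EVertex.subsingleton_path [hr : Fact (6 ≤ r)] (v w : EVertex r) :
    Subsingleton (Quiver.Path v w) := by
  refine ⟨fun p q => ?_⟩
  induction p with
  | nil =>
    cases q with
    | nil => rfl
    | @cons b _ q e =>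
      exfalso
      have he : b.IsArrow v := e.down
      have := EReach.of_path hr.out q
      have := hr.out
      have := b.num_pos
      have := v.num_le
      unfold EVertex.IsArrow at he
      unfold EReach at *
      omega
  | @cons b c p e ih =>
    cases q with
    | nil =>
      exfalso
      have he : b.IsArrow v := e.down
      have := EReach.of_path hr.out p
      have := hr.out
      have := b.num_pos
      have := v.num_le
      unfold EVertex.IsArrow at he
      unfold EReach at *
      omega
    | @cons b' _ q e' =>
      have he : b.IsArrow c := e.down
      have he' : b'.IsArrow c := e'.down
      -- Distinct arrows into `c` exist only at the trivalent node, where they come from different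
      -- arms; a single vertex `v` cannot reach two of them.
      have hb : b = b' := by
        apply EVertex.ext_num
        have hp := EReach.of_path hr.out p
        have hq := EReach.of_path hr.out q
        have := hr.out
        have := b.num_pos
        have := b'.num_pos
        have := c.num_le
        have := v.num_pos
        unfold EVertex.IsArrow at he he'
        unfold EReach at hp hq
        omega
      subst hb
      rw [ih q, show e = e' from Subsingleton.elim (α := PLift (b.IsArrow c)) e e']

theorem EVertex.nonempty_path_of_arm {v : EVertex r} (hv : 3 ≤ v.num) (n : ℕ)
    (hn : v.num ≤ n) (hn' : n + 2 ≤ r) {w : EVertex r} (hw : w.num = n) :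
    Nonempty (Quiver.Path v w) := by
  induction n, hn using Nat.le_induction generalizing w with
  | base =>
    obtain rfl := EVertex.ext_num hw
    exact ⟨.nil⟩
  | succ n hn ih =>
    obtain ⟨u, hu⟩ := EVertex.exists_num (r := r) (n := n) (by omega) (by omega)
    obtain ⟨p⟩ := ih (by omega) hu
    exact ⟨p.cons ⟨by unfold EVertex.IsArrow; omega⟩⟩

theorem EVertex.nonempty_path_iff (hr : 6 ≤ r) (v w : EVertex r) :
    Nonempty (Quiver.Path v w) ↔ EReach r v.num w.num := by
  refine ⟨fun ⟨p⟩ => EReach.of_path hr p, fun h => ?_⟩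
  have arrow {a b : EVertex r} (h : a.IsArrow b) : Nonempty (Quiver.Path a b) :=
    ⟨Quiver.Path.nil.cons ⟨h⟩⟩
  have := v.num_pos
  have := v.num_le
  rcases h with h | h | h | h
  · obtain rfl := EVertex.ext_num h
    exact ⟨.nil⟩
  · by_cases h₁ : v.num = r
    · obtain rfl := EVertex.ext_num (h₁.trans h.symm)
      exact ⟨.nil⟩
    by_cases h₂ : v.num = 1
    · obtain ⟨u, hu⟩ := EVertex.exists_num (r := r) (n := 2) (by omega) (by omega)
      obtain ⟨p⟩ := arrow (a := v) (b := u) (by unfold EVertex.IsArrow; omega)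
      exact ⟨p.cons ⟨by unfold EVertex.IsArrow; omega⟩⟩
    by_cases h₃ : 3 ≤ v.num ∧ v.num + 2 ≤ r
    · obtain ⟨u, hu⟩ := EVertex.exists_num (r := r) (n := r - 2) (by omega) (by omega)
      obtain ⟨p⟩ := EVertex.nonempty_path_of_arm h₃.1 (r - 2) (by omega) (by omega) hu
      exact ⟨p.cons ⟨by unfold EVertex.IsArrow; omega⟩⟩
    · exact arrow (by unfold EVertex.IsArrow; omega)
  · exact arrow (by unfold EVertex.IsArrow; omega)
  · exact EVertex.nonempty_path_of_arm h.1 _ h.2.1 h.2.2 rfl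

end EPaths

/-! ### Thin representations -/

section ThinRep

/-- The linear map between spaces of dimension at most one that is the identity if both `p` and `q`
hold, and zero otherwise. -/
def pliftTransfer (p q : Prop) : (PLift p → ℂ) →ₗ[ℂ] (PLift q → ℂ) := by
  classical
  exact LinearMap.pi fun _ => if h : p then LinearMap.proj ⟨h⟩ else 0

theorem pliftTransfer_apply {p q : Prop} (hp : p) (f : PLift p → ℂ) (x : PLift q) :
    pliftTransfer p q f x = f ⟨hp⟩ := by
  simp [pliftTransfer, hp]

theorem pliftTransfer_apply_of_not {p q : Prop} (hp : ¬p) (f : PLift p → ℂ) :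
    pliftTransfer p q f = 0 := by
  ext x
  simp [pliftTransfer, hp]

variable {r : ℕ}

/-- The linear map attached to a path by a representation. -/
abbrev ERep.lmap (M : ERep r) {v w : Paths (EVertex r)} (p : v ⟶ w) : M.obj v →ₗ[ℂ] M.obj w :=
  (M.map p).hom.hom

/-- The component at a vertex of a morphism of representations. -/
abbrev ERep.lapp {M N : ERep r} (f : M ⟶ N) (v : Paths (EVertex r)) : M.obj v →ₗ[ℂ] N.obj v :=
  (f.app v).hom.hom

theorem ERep.lmap_comp (M : ERep r) {u v w : Paths (EVertex r)} (p : u ⟶ v) (q : v ⟶ w)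
    (x : M.obj u) : M.lmap (p ≫ q) x = M.lmap q (M.lmap p x) := by
  simp [ERep.lmap]

theorem ERep.lmap_id (M : ERep r) (v : Paths (EVertex r)) (x : M.obj v) :
    M.lmap (𝟙 v) x = x := by
  simp [ERep.lmap]

theorem ERep.lapp_lmap {M N : ERep r} (f : M ⟶ N) {v w : Paths (EVertex r)} (p : v ⟶ w)
    (x : M.obj v) : lapp f w (M.lmap p x) = N.lmap p (lapp f v x) := by
  exact congrArg (fun g => g.hom.hom x) (f.naturality p)

/-- The representation with a copy of `ℂ` at each vertex of a convex set of vertices, and identity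
maps between them. -/
def thinRep (U : Set (Paths (EVertex r)))
    (hU : ∀ ⦃a b c : Paths (EVertex r)⦄, (a ⟶ b) → (b ⟶ c) → a ∈ U → c ∈ U → b ∈ U) : ERep r where
  obj v := FGModuleCat.of ℂ (PLift (v ∈ U) → ℂ)
  map _ := FGModuleCat.ofHom (pliftTransfer _ _)
  map_id v := FGModuleCat.hom_ext (LinearMap.ext fun f => funext fun x =>
    pliftTransfer_apply x.down f x)
  map_comp {a b c} p q := FGModuleCat.hom_ext (LinearMap.ext fun f => funext fun x => by
    change pliftTransfer _ _ f x = pliftTransfer _ _ (pliftTransfer _ _ f) x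
    by_cases ha : a ∈ U
    -- Convexity of `U` is what makes the thin maps compose: the middle vertex cannot drop out.
    · have hb := hU p q ha x.down
      rw [pliftTransfer_apply ha, pliftTransfer_apply hb, pliftTransfer_apply ha]
    · rw [pliftTransfer_apply_of_not ha, pliftTransfer_apply_of_not ha, map_zero])

variable {U : Set (Paths (EVertex r))}
  {hU : ∀ ⦃a b c : Paths (EVertex r)⦄, (a ⟶ b) → (b ⟶ c) → a ∈ U → c ∈ U → b ∈ U}

theorem thinRep_lmap_one {v w : Paths (EVertex r)} (p : v ⟶ w) (hv : v ∈ U) :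
    (thinRep U hU).lmap p (fun _ => (1 : ℂ)) = fun _ => (1 : ℂ) :=
  funext fun x => pliftTransfer_apply hv _ x

theorem thinRep_eq_smul_one {v : Paths (EVertex r)} (hv : v ∈ U) (f : (thinRep U hU).obj v) :
    f = (show PLift (v ∈ U) → ℂ from f) ⟨hv⟩ •
      (show (thinRep U hU).obj v from fun _ : PLift (v ∈ U) => (1 : ℂ)) := by
  refine funext fun x => ?_
  change _ = _ * (1 : ℂ)
  rw [mul_one]

theorem thinRep_subsingleton {v : Paths (EVertex r)} (hv : v ∉ U) :
    Subsingleton ((thinRep U hU).obj v) :=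
  have : IsEmpty (PLift (v ∈ U)) := ⟨fun h => hv h.down⟩
  inferInstanceAs (Subsingleton (PLift (v ∈ U) → ℂ))

/-- The linear map from the component of `thinRep U` at `v` that sends the basis vector to `m`. -/
def thinRepDescApp (v : Paths (EVertex r)) {V : Type*} [AddCommGroup V] [Module ℂ V] (m : V) :
    (PLift (v ∈ U) → ℂ) →ₗ[ℂ] V := by
  classical
  exact if h : v ∈ U then (LinearMap.proj (R := ℂ) (φ := fun _ : PLift (v ∈ U) => ℂ)
    ⟨h⟩).smulRight m else 0

theorem thinRepDescApp_apply {v : Paths (EVertex r)} {V : Type*} [AddCommGroup V] [Module ℂ V]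
    (m : V) (hv : v ∈ U) (f : PLift (v ∈ U) → ℂ) : thinRepDescApp v m f = f ⟨hv⟩ • m := by
  simp [thinRepDescApp, hv]

/-- The morphism from `thinRep U` with prescribed images of the basis vectors. -/
def thinRepDesc (M : ERep r) (m : ∀ v : Paths (EVertex r), M.obj v)
    (h₁ : ∀ ⦃v w : Paths (EVertex r)⦄ (p : v ⟶ w), v ∈ U → w ∈ U → M.lmap p (m v) = m w)
    (h₂ : ∀ ⦃v w : Paths (EVertex r)⦄ (p : v ⟶ w), v ∈ U → w ∉ U → M.lmap p (m v) = 0) :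
    thinRep U hU ⟶ M where
  app v := ObjectProperty.homMk (ModuleCat.ofHom (thinRepDescApp v (m v)))
  naturality v w p := FGModuleCat.hom_ext (LinearMap.ext fun f : PLift (v ∈ U) → ℂ => by
    change thinRepDescApp w (m w) (pliftTransfer (v ∈ U) (w ∈ U) f) =
      M.lmap p (thinRepDescApp v (m v) f)
    by_cases hv : v ∈ U
    · rw [thinRepDescApp_apply _ hv, map_smul]
      by_cases hw : w ∈ U
      · rw [thinRepDescApp_apply _ hw, pliftTransfer_apply hv, h₁ p hv hw]
      · rw [h₂ p hv hw, smul_zero]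
        have := thinRep_subsingleton (hU := hU) hw
        exact (congrArg _ (Subsingleton.elim (α := (thinRep U hU).obj w) _ 0)).trans (map_zero _)
    · have := thinRep_subsingleton (hU := hU) hv
      rw [show f = 0 from Subsingleton.elim (α := (thinRep U hU).obj v) _ _]
      rw [map_zero, map_zero, map_zero, map_zero])

theorem thinRepDesc_lapp {M : ERep r} {m : ∀ v : Paths (EVertex r), M.obj v} {h₁ h₂}
    {v : Paths (EVertex r)} (hv : v ∈ U) (f : PLift (v ∈ U) → ℂ) :
    ERep.lapp (thinRepDesc (hU := hU) M m h₁ h₂) v f = f ⟨hv⟩ • m v :=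
  thinRepDescApp_apply _ hv f

end ThinRep

/-! ### Projective representations -/

section ProjectiveRep

variable {r : ℕ}

theorem ERep.hom_ext_lapp {M N : ERep r} {f g : M ⟶ N}
    (h : ∀ v x, lapp f v x = lapp g v x) : f = g :=
  NatTrans.ext (funext fun v => FGModuleCat.hom_ext (LinearMap.ext (h v)))

theorem ERep.lapp_surjective {M N : ERep r} (f : M ⟶ N) [Epi f] (v : Paths (EVertex r)) :
    Function.Surjective (lapp f v) := by
  have : Epi ((forget₂ (FGModuleCat ℂ) (ModuleCat ℂ)).map (f.app v)) := inferInstance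
  exact (ModuleCat.epi_iff_surjective _).1 this

theorem ERep.mono_of_lapp_injective {M N : ERep r} (f : M ⟶ N)
    (h : ∀ v, Function.Injective (lapp f v)) : Mono f := by
  rw [NatTrans.mono_iff_mono_app]
  intro v
  refine (forget₂ (FGModuleCat ℂ) (ModuleCat ℂ)).mono_of_mono_map ?_
  exact (ModuleCat.mono_iff_injective _).2 (h v)

theorem ERep.shortExact_of_lapp (S : ShortComplex (ERep r))
    (h₁ : ∀ v, Function.Injective (lapp S.f v)) (h₂ : ∀ v, Function.Surjective (lapp S.g v))
    (h : ∀ v, Function.Exact (lapp S.f v) (lapp S.g v)) : S.ShortExact := by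
  have hP : JointlyReflectIsomorphisms (fun v : Paths (EVertex r) =>
      (evaluation _ _).obj v ⋙ forget₂ (FGModuleCat ℂ) (ModuleCat ℂ)) := ⟨fun {X Y} f hf => by
    have : ∀ v, IsIso (f.app v) := fun v =>
      have : IsIso ((forget₂ (FGModuleCat ℂ) (ModuleCat ℂ)).map (f.app v)) := hf v
      isIso_of_reflects_iso (f.app v) (forget₂ (FGModuleCat ℂ) (ModuleCat ℂ))
    exact NatIso.isIso_of_isIso_app f⟩
  rw [hP.shortExact_iff]
  intro v
  exact ModuleCat.shortComplex_shortExact _ (h v) (h₁ v) (h₂ v)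

/-- The indecomposable projective representation at the vertex `i`. -/
def projRep (i : Paths (EVertex r)) : ERep r :=
  thinRep {j | Nonempty (i ⟶ j)} fun _ _ _ p _ ⟨q⟩ _ => ⟨q ≫ p⟩

/-- The generator of `projRep i`. -/
def projRepOne (i : Paths (EVertex r)) : (projRep i).obj i :=
  fun _ : PLift (i ∈ {j | Nonempty (i ⟶ j)}) => (1 : ℂ)

theorem projRep_exists_eq_smul {i v : Paths (EVertex r)} (p : i ⟶ v) (x : (projRep i).obj v) :
    ∃ c : ℂ, x = c • (projRep i).lmap p (projRepOne i) := by
  have h := thinRep_lmap_one (U := {j | Nonempty (i ⟶ j)}) (hU := fun _ _ _ p _ ⟨q⟩ _ => ⟨q ≫ p⟩) p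
    ⟨𝟙 i⟩
  exact ⟨(show PLift (Nonempty (i ⟶ v)) → ℂ from x) ⟨⟨p⟩⟩,
    (thinRep_eq_smul_one (U := {j | Nonempty (i ⟶ j)}) ⟨p⟩ x).trans
      (congrArg (_ • ·) h.symm)⟩

theorem projRep_hom_ext {i : Paths (EVertex r)} {M : ERep r} {f g : projRep i ⟶ M}
    (h : ERep.lapp f i (projRepOne i) = ERep.lapp g i (projRepOne i)) : f = g := by
  refine ERep.hom_ext_lapp fun v x => ?_
  by_cases hv : Nonempty (i ⟶ v)
  · obtain ⟨p⟩ := hv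
    obtain ⟨c, rfl⟩ := projRep_exists_eq_smul p x
    rw [map_smul, map_smul, ERep.lapp_lmap, ERep.lapp_lmap, h]
  · have : Subsingleton ((projRep i).obj v) := thinRep_subsingleton (U := {j | Nonempty (i ⟶ j)}) hv
    rw [Subsingleton.elim x 0, map_zero, map_zero]

variable [hr : Fact (6 ≤ r)]

instance (v w : Paths (EVertex r)) : Subsingleton (v ⟶ w) := EVertex.subsingleton_path v w

theorem EVertex.eq_of_hom_of_hom {v w : Paths (EVertex r)} (p : v ⟶ w) (q : w ⟶ v) : v = w :=
  EVertex.ext_num (EReach.antisymm hr.out (EVertex.num_le w) (EReach.of_path hr.out p)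
    (EReach.of_path hr.out q))

/-- The simple representation at the vertex `i`. -/
def simpleRep (i : Paths (EVertex r)) : ERep r :=
  thinRep {j | j = i} fun a b c p q ha hc => by
    obtain rfl : a = i := ha
    obtain rfl : c = a := hc
    exact EVertex.eq_of_hom_of_hom q p

/-- The morphism from `projRep i` to `M` that sends the generator to `m`. -/
def projRepDesc (i : Paths (EVertex r)) (M : ERep r) (m : M.obj i) : projRep i ⟶ M := by
  classical
  refine thinRepDesc M (fun j => if h : Nonempty (i ⟶ j) then M.lmap h.some m else 0) ?_ ?_
  · intro v w p (hv : Nonempty (i ⟶ v)) (hw : Nonempty (i ⟶ w))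
    rw [dif_pos hv, dif_pos hw, ← ERep.lmap_comp, Subsingleton.elim (hv.some ≫ p) hw.some]
  · rintro v w p ⟨q⟩ hw
    exact absurd ⟨q ≫ p⟩ hw

theorem projRepDesc_one (i : Paths (EVertex r)) (M : ERep r) (m : M.obj i) :
    ERep.lapp (projRepDesc i M m) i (projRepOne i) = m := by
  have hi : Nonempty (i ⟶ i) := ⟨𝟙 i⟩
  refine (thinRepDesc_lapp hi _).trans ?_
  rw [dif_pos hi, Subsingleton.elim hi.some (𝟙 i), ERep.lmap_id]
  exact one_smul ℂ m

instance (i : Paths (EVertex r)) : Projective (projRep i) where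
  factors {E X} f e _ := by
    obtain ⟨m, hm⟩ := ERep.lapp_surjective e i (ERep.lapp f i (projRepOne i))
    refine ⟨projRepDesc i E m, projRep_hom_ext ?_⟩
    change ERep.lapp e i (ERep.lapp (projRepDesc i E m) i (projRepOne i)) = _
    rw [projRepDesc_one, hm]

/-- Evaluation at the generator. -/
def projRepHomEquiv (i : Paths (EVertex r)) (M : ERep r) : (projRep i ⟶ M) ≃ₗ[ℂ] M.obj i :=
  LinearEquiv.ofBijective
    { toFun := fun f => ERep.lapp f i (projRepOne i)
      map_add' := fun _ _ => rfl
      map_smul' := fun _ _ => rfl }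
    ⟨fun _ _ h => projRep_hom_ext h, fun m => ⟨projRepDesc i M m, projRepDesc_one i M m⟩⟩

theorem finrank_projRep_hom (i j : EVertex r) :
    Module.finrank ℂ (projRep i ⟶ projRep j) = if EReach r j.num i.num then 1 else 0 := by
  classical
  rw [(projRepHomEquiv (r := r) i (projRep j)).finrank_eq]
  have h := EVertex.nonempty_path_iff hr.out j i
  change Module.finrank ℂ (PLift (Nonempty (Quiver.Path j i)) → ℂ) = _
  by_cases hji : Nonempty (Quiver.Path j i)
  · rw [if_pos (h.1 hji)]
    have : Unique (PLift (Nonempty (Quiver.Path j i))) := ⟨⟨⟨hji⟩⟩, fun _ => rfl⟩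
    rw [Module.finrank_pi, Fintype.card_unique]
  · rw [if_neg (fun h' => hji (h.2 h'))]
    have : IsEmpty (PLift (Nonempty (Quiver.Path j i))) := ⟨fun h => hji h.down⟩
    rw [Module.finrank_pi, Fintype.card_eq_zero]

end ProjectiveRep

/-! ### Simple representations -/

section SimpleRep

variable {r : ℕ}

theorem projRep_lmap_one_ne_zero {i v : Paths (EVertex r)} (p : i ⟶ v) :
    (projRep i).lmap p (projRepOne i) ≠ 0 := fun h => by
  have h' := thinRep_lmap_one (U := {j | Nonempty (i ⟶ j)})
    (hU := fun _ _ _ p _ ⟨q⟩ _ => ⟨q ≫ p⟩) p ⟨𝟙 i⟩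
  exact one_ne_zero (congrFun (h'.symm.trans h) ⟨⟨p⟩⟩ : (1 : ℂ) = 0)

theorem projRep_subsingleton {i v : Paths (EVertex r)} (h : ¬Nonempty (i ⟶ v)) :
    Subsingleton ((projRep i).obj v) :=
  thinRep_subsingleton (U := {j | Nonempty (i ⟶ j)}) h

variable [hr : Fact (6 ≤ r)]

/-- The generator of `simpleRep i`. -/
def simpleRepOne (i : Paths (EVertex r)) : (simpleRep i).obj i :=
  fun _ : PLift (i ∈ {j | j = i}) => (1 : ℂ)

theorem simpleRep_subsingleton {i v : Paths (EVertex r)} (h : v ≠ i) :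
    Subsingleton ((simpleRep i).obj v) :=
  thinRep_subsingleton (U := {j | j = i}) h

theorem simpleRep_exists_eq_smul {i : Paths (EVertex r)} (x : (simpleRep i).obj i) :
    ∃ c : ℂ, x = c • simpleRepOne i :=
  ⟨_, thinRep_eq_smul_one (U := {j | j = i}) rfl x⟩

theorem simpleRepOne_ne_zero (i : Paths (EVertex r)) : simpleRepOne i ≠ 0 := fun h =>
  one_ne_zero (congrFun h ⟨rfl⟩ : (1 : ℂ) = 0)

theorem projRepDesc_lmap_one {i v : Paths (EVertex r)} (M : ERep r) (m : M.obj i) (p : i ⟶ v) :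
    ERep.lapp (projRepDesc i M m) v ((projRep i).lmap p (projRepOne i)) = M.lmap p m := by
  rw [ERep.lapp_lmap, projRepDesc_one]

/-- The projective cover of a simple representation. -/
def projToSimple (i : Paths (EVertex r)) : projRep i ⟶ simpleRep i :=
  projRepDesc i _ (simpleRepOne i)

theorem projToSimple_surjective (i v : Paths (EVertex r)) :
    Function.Surjective (ERep.lapp (projToSimple i) v) := by
  intro x
  by_cases h : v = i
  · subst h
    obtain ⟨c, rfl⟩ := simpleRep_exists_eq_smul x
    exact ⟨c • projRepOne v, by rw [map_smul, projToSimple, projRepDesc_one]⟩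
  · have := simpleRep_subsingleton h
    exact ⟨0, Subsingleton.elim _ _⟩

/-- The inclusion of projective representations attached to a path. -/
def projInc {i j : Paths (EVertex r)} (e : i ⟶ j) : projRep j ⟶ projRep i :=
  projRepDesc j _ ((projRep i).lmap e (projRepOne i))

theorem projInc_lapp {i j v : Paths (EVertex r)} (e : i ⟶ j) (p : j ⟶ v) :
    ERep.lapp (projInc e) v ((projRep j).lmap p (projRepOne j)) =
      (projRep i).lmap (e ≫ p) (projRepOne i) := by
  rw [ERep.lmap_comp, projInc, projRepDesc_lmap_one]

theorem projInc_injective {i j : Paths (EVertex r)} (e : i ⟶ j) (v : Paths (EVertex r)) :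
    Function.Injective (ERep.lapp (projInc e) v) := by
  rw [injective_iff_map_eq_zero]
  intro x hx
  by_cases hv : Nonempty (j ⟶ v)
  · obtain ⟨p⟩ := hv
    obtain ⟨c, rfl⟩ := projRep_exists_eq_smul p x
    rw [map_smul, projInc_lapp] at hx
    rcases smul_eq_zero.1 hx with rfl | hx
    · exact zero_smul _ _
    · exact absurd hx (projRep_lmap_one_ne_zero _)
  · have := projRep_subsingleton hv
    exact Subsingleton.elim _ _

theorem projInc_comp_projToSimple {i j : Paths (EVertex r)} (e : i ⟶ j) (h : j ≠ i) :
    projInc e ≫ projToSimple i = 0 := projRep_hom_ext (by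
  have := simpleRep_subsingleton h
  exact Subsingleton.elim _ _)

/-- By `hij` every vertex other than `i` reached from `i` is also reached from `j`. As paths are
unique, the image of `projRep j` is the whole radical of `projRep i`. -/
theorem projInc_projToSimple_exact {i j : Paths (EVertex r)} (e : i ⟶ j) (h : j ≠ i)
    (hij : ∀ v, (i ⟶ v) → v ≠ i → Nonempty (j ⟶ v)) (v : Paths (EVertex r)) :
    Function.Exact (ERep.lapp (projInc e) v) (ERep.lapp (projToSimple i) v) := by
  intro x
  constructor
  · intro hx
    by_cases hv : Nonempty (i ⟶ v)
    · obtain ⟨p⟩ := hv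
      obtain ⟨c, rfl⟩ := projRep_exists_eq_smul p x
      by_cases hvi : v = i
      · subst hvi
        rw [map_smul, projToSimple, projRepDesc_lmap_one, Subsingleton.elim p (𝟙 v),
          ERep.lmap_id] at hx
        rcases smul_eq_zero.1 hx with rfl | hx
        · exact ⟨0, (map_zero _).trans (zero_smul _ _).symm⟩
        · exact absurd hx (simpleRepOne_ne_zero _)
      · obtain ⟨q⟩ := hij v p hvi
        exact ⟨c • (projRep j).lmap q (projRepOne j), by
          rw [map_smul, projInc_lapp, Subsingleton.elim p (e ≫ q)]⟩
    · have := projRep_subsingleton hv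
      exact ⟨0, Subsingleton.elim _ _⟩
  · rintro ⟨y, rfl⟩
    exact congrArg (fun f => ERep.lapp f v y) (projInc_comp_projToSimple e h)

/-- The short complex `projRep j ⟶ projRep i ⟶ simpleRep i` for a path `i ⟶ j` with `i ≠ j`. -/
def simpleResolution {i j : Paths (EVertex r)} (e : i ⟶ j) (h : j ≠ i) : ShortComplex (ERep r) :=
  ShortComplex.mk (projInc e) (projToSimple i) (projInc_comp_projToSimple e h)

theorem simpleResolution_shortExact {i j : Paths (EVertex r)} (e : i ⟶ j) (h : j ≠ i)
    (hij : ∀ v, (i ⟶ v) → v ≠ i → Nonempty (j ⟶ v)) : (simpleResolution e h).ShortExact :=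
  ERep.shortExact_of_lapp _ (projInc_injective e) (projToSimple_surjective i)
    (projInc_projToSimple_exact e h hij)

/-- The morphism from `simpleRep i` that sends the generator to a vector killed by all arrows. -/
def simpleRepDesc {i : Paths (EVertex r)} (M : ERep r) (m : M.obj i)
    (hm : ∀ v (p : i ⟶ v), v ≠ i → M.lmap p m = 0) : simpleRep i ⟶ M := by
  classical
  refine thinRepDesc M (fun j => if h : j = i then M.lmap (eqToHom h.symm) m else 0) ?_ ?_
  · rintro v w p (rfl : v = i) (rfl : w = v)
    rw [dif_pos rfl, ← ERep.lmap_comp]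
    exact congrArg (fun q => M.lmap q m) (Subsingleton.elim _ _)
  · rintro v w p (rfl : v = i) hw
    rw [dif_pos rfl, eqToHom_refl, ERep.lmap_id]
    exact hm w p hw

theorem simpleRepDesc_one {i : Paths (EVertex r)} (M : ERep r) (m : M.obj i)
    (hm : ∀ v (p : i ⟶ v), v ≠ i → M.lmap p m = 0) :
    ERep.lapp (simpleRepDesc M m hm) i (simpleRepOne i) = m := by
  refine (thinRepDesc_lapp (U := {j | j = i}) rfl _).trans ?_
  rw [dif_pos rfl, eqToHom_refl, ERep.lmap_id]
  exact one_smul ℂ m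

theorem simpleRepDesc_mono {i : Paths (EVertex r)} (M : ERep r) {m : M.obj i} (h0 : m ≠ 0)
    (hm : ∀ v (p : i ⟶ v), v ≠ i → M.lmap p m = 0) : Mono (simpleRepDesc M m hm) := by
  refine ERep.mono_of_lapp_injective _ fun v => ?_
  rw [injective_iff_map_eq_zero]
  intro x hx
  by_cases h : v = i
  · subst h
    obtain ⟨c, rfl⟩ := simpleRep_exists_eq_smul x
    rw [map_smul, simpleRepDesc_one] at hx
    rcases smul_eq_zero.1 hx with rfl | hx
    · exact zero_smul _ _
    · exact absurd hx h0
  · have := simpleRep_subsingleton h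
    exact Subsingleton.elim _ _

instance : Fintype (Paths (EVertex r)) :=
  Fintype.ofEquiv (Fin r) ⟨EVertex.mk, EVertex.idx, fun _ => rfl, fun _ => rfl⟩

/-- Every representation is obtained from simple ones by extensions. -/
theorem ERep.induction_simple (Q : ERep r → Prop) (h0 : ∀ M, IsZero M → Q M)
    (hS : ∀ i, Q (simpleRep i)) (hext : ∀ S : ShortComplex (ERep r), S.ShortExact →
      Q S.X₁ → Q S.X₃ → Q S.X₂) (M : ERep r) : Q M := by
  classical
  induction hd : ∑ v : Paths (EVertex r), Module.finrank ℂ (M.obj v) using Nat.strong_induction_on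
    generalizing M with
  | _ d ih =>
  by_cases hM : ∃ v : Paths (EVertex r), ∃ m : M.obj v, m ≠ 0
  -- Arrows increase the vertex number, so a nonzero vector at the largest vertex of the support is
  -- killed by every nontrivial path and spans a simple subrepresentation. The cokernel has smaller
  -- total dimension.
  · obtain ⟨i, ⟨m, hm⟩, hmax⟩ : ∃ i : Paths (EVertex r), (∃ m : M.obj i, m ≠ 0) ∧
        ∀ w : Paths (EVertex r), (∃ m : M.obj w, m ≠ 0) →
          EVertex.num (r := r) w ≤ EVertex.num (r := r) i := by
      obtain ⟨i, hi, hi'⟩ := Finset.exists_max_image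
        (Finset.univ.filter fun v : Paths (EVertex r) => ∃ m : M.obj v, m ≠ 0) (EVertex.num (r := r))
        (by obtain ⟨v, hv⟩ := hM; exact ⟨v, by simpa using hv⟩)
      exact ⟨i, by simpa using hi, fun w hw => hi' w (by simpa using hw)⟩
    have hkill : ∀ v (p : i ⟶ v), v ≠ i → M.lmap p m = 0 := by
      intro v p hv
      by_contra hne
      have h1 := hmax v ⟨_, hne⟩
      have h2 := EReach.of_path hr.out p
      have h3 := EVertex.num_le (r := r) i
      have h4 := EVertex.num_le (r := r) v
      apply hv
      apply EVertex.ext_num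
      unfold EReach at h2
      omega
    let f := simpleRepDesc M m hkill
    have : Mono f := simpleRepDesc_mono M hm hkill
    let S : ShortComplex (ERep r) := ShortComplex.mk f (cokernel.π f) (cokernel.condition f)
    have hSE : S.ShortExact := { exact := ShortComplex.exact_cokernel f }
    refine hext S hSE (hS i) (ih _ ?_ _ rfl)
    rw [← hd]
    have hsurj := fun v => ERep.lapp_surjective (cokernel.π f) v
    refine Finset.sum_lt_sum (fun v _ => LinearMap.finrank_le_finrank_of_surjective (hsurj v))
      ⟨i, Finset.mem_univ _, ?_⟩
    have hz : ERep.lapp (cokernel.π f) i m = 0 := by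
      have := congrArg (fun g => ERep.lapp g i (simpleRepOne i)) (cokernel.condition f)
      change ERep.lapp (cokernel.π f) i (ERep.lapp f i (simpleRepOne i)) = 0 at this
      rwa [simpleRepDesc_one] at this
    refine lt_of_le_of_ne (LinearMap.finrank_le_finrank_of_surjective (hsurj i)) fun heq => hm ?_
    exact (LinearMap.injective_iff_surjective_of_finrank_eq_finrank heq.symm).2 (hsurj i)
      (hz.trans (map_zero _).symm)
  · push Not at hM
    refine h0 M ?_
    rw [IsZero.iff_id_eq_zero]
    exact ERep.hom_ext_lapp fun v x => by rw [hM v x, map_zero, map_zero]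

end SimpleRep

/-! ### Representations as complexes concentrated in degree zero -/

section Single

open CategoryTheory.Pretriangulated

variable {r : ℕ}

/-- The standard t-structure on the bounded derived category. -/
abbrev eTStructure (r : ℕ) : Triangulated.TStructure (EDerived r) :=
  (DerivedCategory.TStructure.t (C := ERep r)).onBounded

/-- A representation, as a complex concentrated in degree zero. -/
def eSingle (r : ℕ) : ERep r ⥤ EDerived r :=
  ObjectProperty.lift _ (DerivedCategory.singleFunctor (ERep r) 0)
    fun _ => ⟨⟨0, inferInstance⟩, ⟨0, inferInstance⟩⟩

instance : (eSingle r).Faithful where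
  map_injective h := (DerivedCategory.singleFunctor (ERep r) 0).map_injective
    (congrArg ((DerivedCategory.TStructure.t (C := ERep r)).bounded.ι.map) h)

instance : (eSingle r).Full where
  map_surjective f := by
    obtain ⟨g, hg⟩ := (DerivedCategory.singleFunctor (ERep r) 0).map_surjective
      ((DerivedCategory.TStructure.t (C := ERep r)).bounded.ι.map f)
    exact ⟨g, (DerivedCategory.TStructure.t (C := ERep r)).bounded.ι.map_injective hg⟩

instance (M : ERep r) : (eTStructure r).IsLE ((eSingle r).obj M) 0 :=
  (ObjectProperty.tStructure_isLE_iff _ _ _ _).2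
    (inferInstanceAs (((DerivedCategory.singleFunctor (ERep r) 0).obj M).IsLE 0))

instance (M : ERep r) : (eTStructure r).IsGE ((eSingle r).obj M) 0 :=
  (ObjectProperty.tStructure_isGE_iff _ _ _ _).2
    (inferInstanceAs (((DerivedCategory.singleFunctor (ERep r) 0).obj M).IsGE 0))

/-- The action of `eSingle` on morphisms, as a linear map. -/
def eSingleMap (M N : ERep r) :
    (M ⟶ N) →ₗ[ℂ] ((eSingle r).obj M ⟶ (eSingle r).obj N) where
  toFun f := (eSingle r).map f
  map_add' f g := (DerivedCategory.TStructure.t (C := ERep r)).bounded.ι.map_injective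
    (Functor.map_add (DerivedCategory.singleFunctor (ERep r) 0))
  map_smul' c f := by
    apply (DerivedCategory.TStructure.t (C := ERep r)).bounded.ι.map_injective
    rw [RingHom.id_apply, Functor.map_smul (DerivedCategory.TStructure.t (C := ERep r)).bounded.ι]
    have h := Functor.map_smul (R := ℂ) (DerivedCategory.singleFunctor (ERep r) 0) c f
    exact h

/-- `eSingle` is fully faithful. -/
def eSingleHomEquiv (M N : ERep r) :
    (M ⟶ N) ≃ₗ[ℂ] ((eSingle r).obj M ⟶ (eSingle r).obj N) :=
  LinearEquiv.ofBijective (eSingleMap M N) ⟨fun _ _ h => (eSingle r).map_injective h,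
    fun f => (eSingle r).map_surjective f⟩

theorem exists_eSingle_triangle {S : ShortComplex (ERep r)} (hS : S.ShortExact) :
    ∃ δ : (eSingle r).obj S.X₃ ⟶ ((eSingle r).obj S.X₁)⟦(1 : ℤ)⟧,
      Triangle.mk ((eSingle r).map S.f) ((eSingle r).map S.g) δ ∈ distTriang (EDerived r) := by
  let ι := (DerivedCategory.TStructure.t (C := ERep r)).bounded.ι
  refine ⟨(DerivedCategory.TStructure.t (C := ERep r)).bounded.fullyFaithfulι.preimage
    (hS.singleδ ≫ (ι.commShiftIso (1 : ℤ)).inv.app ((eSingle r).obj S.X₁)), ?_⟩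
  refine isomorphic_distinguished _ hS.singleTriangle_distinguished _ ?_
  refine Triangle.isoMk _ _ (Iso.refl _) (Iso.refl _) (Iso.refl _) ?_ ?_ ?_
  · simp
    rfl
  · simp
    rfl
  · refine (congrArg (_ ≫ ·) (CategoryTheory.Functor.map_id _ _)).trans ?_
    refine (Category.comp_id _).trans (Eq.trans ?_ (Category.id_comp _).symm)
    exact (Category.assoc _ _ _).trans ((congrArg (hS.singleδ ≫ ·)
      (Iso.inv_hom_id_app (ι.commShiftIso (1 : ℤ)) ((eSingle r).obj S.X₁))).trans
        (Category.comp_id _))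

theorem exists_iso_eSingle_shift (X : EDerived r) (n m : ℤ) (h : m + n = 0)
    [hle : (eTStructure r).IsLE X n]
    [hge : (eTStructure r).IsGE X n] : ∃ M : ERep r, Nonempty (X ≅ ((eSingle r).obj M)⟦m⟧) := by
  have h₁ := (eTStructure r).isLE_shift X n n 0 (by lia)
  have h₂ := (eTStructure r).isGE_shift X n n 0 (by lia)
  rw [ObjectProperty.tStructure_isLE_iff] at h₁
  rw [ObjectProperty.tStructure_isGE_iff] at h₂
  obtain ⟨M, ⟨e⟩⟩ := DerivedCategory.exists_iso_singleFunctor_obj_of_isGE_of_isLE (X⟦n⟧).obj 0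
  refine ⟨M, ⟨(shiftShiftNeg X n).symm ≪≫ (shiftFunctor _ (-n)).mapIso
    (ObjectProperty.isoMk _ e : X⟦n⟧ ≅ (eSingle r).obj M) ≪≫ eqToIso (by congr; lia)⟩⟩

theorem eq_zero_of_projective {P : ERep r} [Projective P] (Y : EDerived r) (n : ℤ) (hn : n < 0)
    [hY : (eTStructure r).IsLE Y n] (f : (eSingle r).obj P ⟶ Y) : f = 0 := by
  rw [ObjectProperty.tStructure_isLE_iff] at hY
  obtain ⟨L, _, ⟨e⟩⟩ := DerivedCategory.exists_iso_Q_obj_of_isLE Y.obj n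
  let ι := (DerivedCategory.TStructure.t (C := ERep r)).bounded.ι
  refine ι.map_injective ?_
  have := DerivedCategory.from_singleFunctor_obj_eq_zero_of_projective (P := P) (i := 0)
    (L := L) (ι.map f ≫ e.hom) n hn
  rw [← cancel_mono e.hom]
  exact this.trans zero_comp.symm

end Single

/-! ### The projectives generate the bounded derived category -/

section ProjGenerates

open CategoryTheory.Pretriangulated ZeroObject

variable {r : ℕ} [hr : Fact (6 ≤ r)]

/-- The indecomposable projectives, as objects of the bounded derived category. -/
def eProj (r : ℕ) (i : Fin r) : EDerived r :=
  (eSingle r).obj (projRep (EVertex.mk i : EVertex r))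

theorem simpleRep_shortExact_of_num_eq {i : Paths (EVertex r)} (hi : EVertex.num (r := r) i = r) :
    (ShortComplex.mk (0 : 0 ⟶ projRep i) (projToSimple i) zero_comp).ShortExact := by
  have hinj : ∀ v, Function.Injective (ERep.lapp (projToSimple i) v) := fun v => by
    rw [injective_iff_map_eq_zero]
    intro x hx
    by_cases hv : Nonempty (i ⟶ v)
    · obtain ⟨p⟩ := hv
      have h := EReach.of_path hr.out p
      have h₁ := EVertex.num_le (r := r) v
      obtain rfl : v = i := EVertex.ext_num (by unfold EReach at h; have := hr.out; omega)
      obtain ⟨c, rfl⟩ := projRep_exists_eq_smul p x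
      rw [map_smul, projToSimple, projRepDesc_lmap_one, Subsingleton.elim p (𝟙 v),
        ERep.lmap_id] at hx
      rcases smul_eq_zero.1 hx with rfl | hx
      · exact zero_smul _ _
      · exact absurd hx (simpleRepOne_ne_zero _)
    · have := projRep_subsingleton hv
      exact Subsingleton.elim _ _
  refine ERep.shortExact_of_lapp _ (fun v => ?_) (projToSimple_surjective i) fun v x => ⟨?_, ?_⟩
  · rw [injective_iff_map_eq_zero]
    intro x _
    exact congrArg (fun f => ERep.lapp f v x)
      ((isZero_zero (ERep r)).eq_of_src (𝟙 (0 : ERep r)) 0)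
  · intro hx
    exact ⟨0, (map_zero _).trans (hinj v (hx.trans (map_zero _).symm)).symm⟩
  · rintro ⟨y, rfl⟩
    exact map_zero _

/-- All arrows point towards the node `r`, and every other vertex has exactly one outgoing arrow;
`j` is its target. -/
theorem exists_simpleResolution (i : Paths (EVertex r)) (hi : EVertex.num (r := r) i ≠ r) :
    ∃ (j : Paths (EVertex r)) (e : i ⟶ j) (h : j ≠ i), (simpleResolution e h).ShortExact := by
  have h₁ := EVertex.num_le (r := r) i
  have h₂ := EVertex.num_pos (r := r) i
  have h₃ := hr.out
  have key (n : ℕ) (hn : 1 ≤ n) (hn' : n ≤ r) (hne : n ≠ EVertex.num (r := r) i)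
      (hr₁ : EReach r (EVertex.num (r := r) i) n)
      (hr₂ : ∀ m, m ≤ r → EReach r (EVertex.num (r := r) i) m → m ≠ EVertex.num (r := r) i →
        EReach r n m) :
      ∃ (j : Paths (EVertex r)) (e : i ⟶ j) (h : j ≠ i), (simpleResolution e h).ShortExact := by
    obtain ⟨j, rfl⟩ := EVertex.exists_num hn hn'
    obtain ⟨e⟩ := (EVertex.nonempty_path_iff h₃ i j).2 hr₁
    refine ⟨j, e, fun h => hne (congrArg _ h), simpleResolution_shortExact _ _ fun v p hv => ?_⟩
    exact (EVertex.nonempty_path_iff h₃ j v).2 (hr₂ _ (EVertex.num_le (r := r) v)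
      (EReach.of_path h₃ p) fun h => hv (EVertex.ext_num h))
  generalize EVertex.num (r := r) i = n at *
  by_cases hn : n = 1
  · exact key 2 (by omega) (by omega) (by omega) (by unfold EReach; omega)
      (by unfold EReach; omega)
  · by_cases hn' : 3 ≤ n ∧ n + 3 ≤ r
    · exact key (n + 1) (by omega) (by omega) (by omega) (by unfold EReach; omega)
        (by unfold EReach; omega)
    · exact key r (by omega) (by omega) (by omega) (by unfold EReach; omega)
        (by unfold EReach; omega)

/-- An induction principle for properties of bounded complexes that are stable under extensions. -/
theorem eSingle_induction (Q : EDerived r → Prop) (h0 : ∀ X, IsZero X → Q X)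
    (hext : ∀ T ∈ distTriang (EDerived r), Q T.obj₁ → Q T.obj₃ → Q T.obj₂)
    (hP : ∀ i, Q (eProj r i)) (hP' : ∀ i, Q ((eProj r i)⟦(1 : ℤ)⟧)) (M : ERep r) :
    Q ((eSingle r).obj M) := by
  have hz : ∀ M : ERep r, IsZero M → IsZero ((eSingle r).obj M) := fun M hM => by
    rw [IsZero.iff_id_eq_zero, ← (eSingle r).map_id, hM.eq_of_src (𝟙 M) 0]
    exact map_zero (eSingleHomEquiv M M)
  -- The rotated triangle presents the quotient as an extension of `S.X₁[1]` and `S.X₂`. Resolutions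
  -- of simples have length at most one, so only the shifts 0 and 1 of the projectives occur, and
  -- `Q` need not be stable under shifts.
  have rot {S : ShortComplex (ERep r)} (hS : S.ShortExact) (h₂ : Q ((eSingle r).obj S.X₂))
      (h₁ : Q (((eSingle r).obj S.X₁)⟦(1 : ℤ)⟧)) : Q ((eSingle r).obj S.X₃) := by
    obtain ⟨δ, hT⟩ := exists_eSingle_triangle hS
    exact hext _ (rot_of_distTriang _ hT) h₂ h₁
  refine ERep.induction_simple (fun M => Q ((eSingle r).obj M)) (fun M hM => h0 _ (hz M hM)) ?_ ?_ M
  · intro i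
    by_cases hi : EVertex.num (r := r) i = r
    · refine rot (simpleRep_shortExact_of_num_eq hi) (hP i.idx) (h0 _ ?_)
      exact (shiftFunctor (EDerived r) (1 : ℤ)).map_isZero (hz _ (isZero_zero _))
    · obtain ⟨j, e, h, hS⟩ := exists_simpleResolution i hi
      exact rot hS (hP i.idx) (hP' j.idx)
  · intro S hS h₁ h₃
    obtain ⟨δ, hT⟩ := exists_eSingle_triangle hS
    exact hext _ hT h₁ h₃

theorem generates_eProj : Generates (eProj r) := by
  intro Q hiso hshift hext hP
  have h0 : ∀ X, IsZero X → Q X := by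
    intro X hX
    have h := hP ⟨0, by have := hr.out; omega⟩
    refine hiso (((isZero_zero _).iso hX)) (hext _
      (rot_of_distTriang _ (contractible_distinguished (eProj r ⟨0, by have := hr.out; omega⟩)))
      h (hshift _ 1 h))
  have hM := eSingle_induction Q h0 hext hP fun i => hshift _ 1 (hP i)
  -- Induction on the cohomological amplitude: truncation splits off the top cohomology, which is a
  -- shifted representation.
  have hbdd : ∀ (d : ℕ) (X : EDerived r) (n m : ℤ), n = m + d → (eTStructure r).IsLE X n →
      (eTStructure r).IsGE X m → Q X := by
    intro d
    induction d with
    | zero =>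
      intro X n m hn h₁ h₂
      obtain rfl : n = m := by simpa using hn
      obtain ⟨M, ⟨e⟩⟩ := exists_iso_eSingle_shift X n (-n) (by lia)
      exact hiso e.symm (hshift _ _ (hM M))
    | succ d ih =>
      intro X n m hn h₁ h₂
      refine hext _ ((eTStructure r).triangleLTGE_distinguished n X) ?_ ?_
      · refine ih _ (n - 1) m (by push_cast at hn; lia) inferInstance ?_
        change (eTStructure r).IsGE (((eTStructure r).truncLT n).obj X) m
        infer_instance
      · have h₃ : (eTStructure r).IsLE (((eTStructure r).truncGE n).obj X) n := inferInstance
        obtain ⟨M, ⟨e⟩⟩ := exists_iso_eSingle_shift (((eTStructure r).truncGE n).obj X) n (-n)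
          (by lia)
        exact hiso e.symm (hshift _ _ (hM M))
  intro X
  obtain ⟨⟨m, hm⟩, ⟨n, hn⟩⟩ := X.property
  rw [← ObjectProperty.tStructure_isGE_iff] at hm
  rw [← ObjectProperty.tStructure_isLE_iff] at hn
  have := (eTStructure r).isLE_of_le X n (max n m)
  exact hbdd (max n m - m).toNat X (max n m) m (by lia) this hm

end ProjGenerates

/-! ### Morphisms from representations -/

section EndOne

open CategoryTheory.Pretriangulated

universe v u

variable {C : Type u} [Category.{v} C] [Preadditive C] [HasShift C ℤ] [Linear ℂ C]
  [∀ n : ℤ, (shiftFunctor C n).Additive] [HasZeroObject C] [Pretriangulated C]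

/-- A vanishing connecting map makes `T.obj₃` a direct summand of `T.obj₂`. The corresponding
idempotent is a scalar, and it must be the identity because the summand is nonzero. -/
theorem isIso_mor₂_of_finrank_end {T : Triangle C} (hT : T ∈ distTriang C) (h₃ : T.mor₃ = 0)
    (hT₃ : ¬IsZero T.obj₃) (h : Module.finrank ℂ (T.obj₂ ⟶ T.obj₂) = 1) : IsIso T.mor₂ := by
  obtain ⟨s, hs⟩ := Triangle.coyoneda_exact₃ T hT (𝟙 T.obj₃) (by rw [h₃, comp_zero])
  have hs0 : s ≠ 0 := fun h0 => hT₃ (by rw [IsZero.iff_id_eq_zero, hs, h0, zero_comp])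
  have hid : (𝟙 T.obj₂) ≠ 0 := fun h0 => hs0 (by rw [← Category.comp_id s, h0, comp_zero])
  obtain ⟨c, hc⟩ := (finrank_eq_one_iff_of_nonzero' _ hid).1 h (T.mor₂ ≫ s)
  have h₁ : (1 - c) • s = 0 := by
    rw [sub_smul, one_smul, sub_eq_zero]
    calc s = (s ≫ T.mor₂) ≫ s := by rw [← hs, Category.id_comp]
      _ = c • s := by rw [Category.assoc, ← hc, Linear.comp_smul, Category.comp_id]
  have h₂ : c = 1 := (sub_eq_zero.1 ((smul_eq_zero.1 h₁).resolve_right hs0)).symm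
  exact ⟨s, by rw [← hc, h₂, one_smul], hs.symm⟩

end EndOne

section Concentrated

open CategoryTheory.Pretriangulated

variable {r : ℕ} [hr : Fact (6 ≤ r)]

theorem eProj_hom_eq_zero (i : Fin r) (Y : EDerived r) (n : ℤ) (hn : n < 0)
    [(eTStructure r).IsLE Y n] (f : eProj r i ⟶ Y) : f = 0 := by
  have : Projective (projRep (EVertex.mk i : EVertex r)) :=
    (inferInstance : ∀ j : Paths (EVertex r), Projective (projRep j)) _
  exact eq_zero_of_projective Y n hn f

theorem eProj_hom_shift_eq_zero (i : Fin r) (M : ERep r) {m : ℤ} (hm : m ≠ 0)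
    (f : eProj r i ⟶ ((eSingle r).obj M)⟦m⟧) : f = 0 := by
  have h₁ := (eTStructure r).isLE_shift ((eSingle r).obj M) 0 m (-m)
  have h₂ := (eTStructure r).isGE_shift ((eSingle r).obj M) 0 m (-m)
  rcases lt_or_gt_of_ne hm with hm | hm
  · have h₃ : (eTStructure r).IsLE (eProj r i) 0 :=
      inferInstanceAs ((eTStructure r).IsLE ((eSingle r).obj _) 0)
    exact (eTStructure r).zero f 0 (-m)
  · exact eProj_hom_eq_zero i _ (-m) (by lia) f

/-- Morphisms of degree zero from a projective to a representation. -/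
def eProjHomShiftZeroEquiv (i : Fin r) (M : ERep r) :
    (eProj r i ⟶ ((eSingle r).obj M)⟦(0 : ℤ)⟧) ≃ₗ[ℂ] (projRep (EVertex.mk i : EVertex r) ⟶ M) :=
  (Linear.homCongr ℂ (Iso.refl (eProj r i))
    ((shiftFunctorZero (EDerived r) ℤ).app ((eSingle r).obj M))).trans (eSingleHomEquiv _ M).symm

theorem homDim_eProj (i : Fin r) (M : ERep r) :
    homDim (eProj r i) ((eSingle r).obj M) = fun n : ℤ =>
      if n = 0 then Module.finrank ℂ (projRep (EVertex.mk i : EVertex r) ⟶ M) else 0 := by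
  funext n
  by_cases hn : n = 0
  · subst hn
    exact (eProjHomShiftZeroEquiv i M).finrank_eq
  · rw [if_neg hn, homDim]
    have := subsingleton_of_forall_eq 0 (eProj_hom_shift_eq_zero i M hn)
    exact Module.finrank_zero_of_subsingleton

theorem eulerForm_eProj (i : Fin r) (M : ERep r) : eulerForm (eProj r i) ((eSingle r).obj M) =
    Module.finrank ℂ (projRep (EVertex.mk i : EVertex r) ⟶ M) := by
  rw [eulerForm, homDim_eProj, alternatingSum, finsum_eq_single _ 0 fun n hn => by simp [hn]]
  simp

theorem homFinite_eProj (i j : Fin r) : HomFinite (eProj r i) (eProj r j) where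
  finiteDimensional n := by
    by_cases hn : n = 0
    · subst hn
      have e := (eProjHomShiftZeroEquiv i (projRep (EVertex.mk j : EVertex r))).trans
        (projRepHomEquiv (r := r) _ _)
      exact Module.Finite.equiv e.symm
    · have : Subsingleton (eProj r i ⟶ (eProj r j)⟦n⟧) :=
        subsingleton_of_forall_eq 0 (eProj_hom_shift_eq_zero i _ hn)
      infer_instance
  finite_support := by
    rw [eProj.eq_1 r j, homDim_eProj]
    exact (Set.finite_singleton 0).subset fun n hn => by
      by_contra h
      exact hn (if_neg h)

theorem eulerForm_eProj_eProj (i j : Fin r) :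
    eulerForm (eProj r i) (eProj r j) = eCartan r i j := by
  rw [eProj.eq_1 r j, eulerForm_eProj, finrank_projRep_hom, eCartan]
  push_cast
  rfl

/-- The category of representations is hereditary. -/
theorem eSingle_hom_eq_zero (M : ERep r) (Y : EDerived r) [hY : (eTStructure r).IsLE Y (-2)]
    (f : (eSingle r).obj M ⟶ Y) : f = 0 := by
  refine eSingle_induction (fun X => ∀ f : X ⟶ Y, f = 0) (fun X hX f => hX.eq_of_src _ _) ?_
    (fun i f => eProj_hom_eq_zero i Y (-2) (by norm_num) f) (fun i f => ?_) M f
  · intro T hT h₁ h₃ f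
    obtain ⟨g, rfl⟩ := Triangle.yoneda_exact₂ T hT f (h₁ _)
    rw [h₃ g, comp_zero]
  · have h := (eTStructure r).isLE_shift Y (-2) (-1) (-1)
    apply (shiftFunctor (EDerived r) (-1 : ℤ)).map_injective
    rw [Functor.map_zero, ← cancel_epi ((shiftShiftNeg (eProj r i) (1 : ℤ)).inv), comp_zero]
    exact eProj_hom_eq_zero i _ (-1) (by norm_num) _

/-- An object with one-dimensional endomorphism space is concentrated in one degree. -/
theorem exists_iso_eSingle_shift_of_finrank_end {A : EDerived r} (hA : ¬IsZero A)
    (h : Module.finrank ℂ (A ⟶ A) = 1) :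
    ∃ (M : ERep r) (n : ℤ), Nonempty (A ≅ ((eSingle r).obj M)⟦n⟧) := by
  -- `n` is the top degree with nonzero cohomology.
  obtain ⟨n, hn, hn'⟩ : ∃ n, (eTStructure r).IsLE A n ∧ ¬(eTStructure r).IsLE A (n - 1) := by
    obtain ⟨⟨m, hm⟩, ⟨n, hn⟩⟩ := A.property
    rw [← ObjectProperty.tStructure_isGE_iff] at hm
    rw [← ObjectProperty.tStructure_isLE_iff] at hn
    obtain ⟨k, hk, hk'⟩ := Int.exists_least_of_bdd (P := fun k => (eTStructure r).IsLE A k)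
      ⟨m, fun k hk => by
        by_contra hlt
        exact hA ((eTStructure r).isZero A k m)⟩ ⟨n, hn⟩
    exact ⟨k, hk, fun h => by have := hk' _ h; lia⟩
  have hT := (eTStructure r).triangleLTGE_distinguished n A
  have hZ : ¬IsZero (((eTStructure r).truncGE n).obj A) := fun hZ =>
    hn' (((eTStructure r).isLE_iff_isZero_truncGE_obj (n - 1) n (by lia) A).2 hZ)
  -- The connecting map goes from a representation in degree `n` to an object in degrees at most `n
  -- - 2`, so it vanishes by heredity.
  have h₃ : (((eTStructure r).triangleLTGE n).obj A).mor₃ = 0 := by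
    obtain ⟨M, ⟨e⟩⟩ := exists_iso_eSingle_shift (((eTStructure r).truncGE n).obj A) n (-n) (by lia)
    have h₁ := (eTStructure r).isLE_shift (((eTStructure r).truncLT n).obj A) (n - 1) 1 (n - 2)
    have h₂ := (eTStructure r).isLE_shift
      ((((eTStructure r).truncLT n).obj A)⟦(1 : ℤ)⟧) (n - 2) n (-2)
    have key (g : ((eSingle r).obj M)⟦-n⟧ ⟶ (((eTStructure r).truncLT n).obj A)⟦(1 : ℤ)⟧) :
        g = 0 := by
      apply (shiftFunctor (EDerived r) n).map_injective
      rw [Functor.map_zero, ← cancel_epi ((shiftNegShift ((eSingle r).obj M) n).inv), comp_zero]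
      exact eSingle_hom_eq_zero M _ _
    exact (cancel_epi e.inv).1 ((key _).trans comp_zero.symm)
  have hiso := isIso_mor₂_of_finrank_end hT h₃ hZ h
  obtain ⟨M, ⟨e⟩⟩ := exists_iso_eSingle_shift (((eTStructure r).truncGE n).obj A) n (-n) (by lia)
  exact ⟨M, -n, ⟨@asIso _ _ _ _ _ hiso ≪≫ e⟩⟩

/-- For a shifted representation, the Euler forms against the projectives are, up to one common
sign, its dimension vector. The condition on endomorphisms excludes cancellation between degrees, as
in `X ⊕ X[1]`. -/
theorem isZero_of_eulerForm_eProj_eq_zero {A : EDerived r}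
    (h : Module.finrank ℂ (A ⟶ A) = 1) (h0 : ∀ i, eulerForm (eProj r i) A = 0) : IsZero A := by
  by_contra hA
  obtain ⟨M, n, ⟨e⟩⟩ := exists_iso_eSingle_shift_of_finrank_end hA h
  refine hA (IsZero.of_iso ((shiftFunctor (EDerived r) n).map_isZero
    (generates_eProj.isZero ((eSingle r).obj M) fun i m => ?_)) e)
  have hi := h0 i
  rw [eulerForm, homDim_congr (Iso.refl _) e, ← eulerForm, eulerForm_shift_right,
    eulerForm_eProj, mul_eq_zero_iff_left (Units.ne_zero _), Nat.cast_eq_zero] at hi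
  by_cases hm : m = 0
  · subst hm
    have := (generates_eProj.homFinite (homFinite_eProj (r := r))
      (eProj r i) ((eSingle r).obj M)).finiteDimensional 0
    rw [← Module.finrank_zero_iff (R := ℂ), (eProjHomShiftZeroEquiv i M).finrank_eq, hi]
  · exact subsingleton_of_forall_eq 0 (eProj_hom_shift_eq_zero i _ hm)

end Concentrated

/-! ### Serre duality and Euler forms -/

section SerreDual

set_option linter.unusedSectionVars false

universe v u

variable {C : Type u} [Category.{v} C] [Preadditive C] [HasShift C ℤ] [Linear ℂ C]
  [∀ n : ℤ, (shiftFunctor C n).Additive] [∀ n : ℤ, (shiftFunctor C n).Linear ℂ]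

theorem IsSerreDual.homDim_eq {X Y : C} (h : IsSerreDual X Y) (Z : C) :
    homDim Z Y = fun n => homDim X Z (-n) := by
  funext n
  obtain ⟨e, -⟩ := h
  have e₁ := homShiftLeftEquiv Z Y (-n) n 0 (by ring)
  have e₂ : (Z⟦-n⟧ ⟶ Y⟦(0 : ℤ)⟧) ≃ₗ[ℂ] (Z⟦-n⟧ ⟶ Y) :=
    Linear.homCongr ℂ (Iso.refl _) ((shiftFunctorZero C ℤ).app Y)
  rw [homDim, ((e₁.trans e₂).trans (e _)).finrank_eq, Subspace.dual_finrank_eq, homDim]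

theorem IsSerreDual.eulerForm_eq_neg {X Y : C} (h : IsSerreDual X (Y⟦(1 : ℤ)⟧)) (Z : C) :
    eulerForm Z Y = -eulerForm X Z := by
  have h₁ : eulerForm Z (Y⟦(1 : ℤ)⟧) = eulerForm X Z := by
    unfold eulerForm alternatingSum
    rw [h.homDim_eq, ← finsum_comp_equiv (Equiv.neg ℤ)]
    simp [Int.negOnePow_neg]
  rw [eulerForm_shift_right, Int.negOnePow_one] at h₁
  simpa [neg_eq_iff_eq_neg] using h₁

/-- Serre duality reverses and translates the degrees without changing the total. With `Z = X = A`
it shows that `A` and `τA` contribute equally to the spherical sum. -/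
theorem IsSerreDual.finsum_homDim_eq {X Y : C} (h : IsSerreDual X (Y⟦(1 : ℤ)⟧)) (Z : C) :
    ∑ᶠ n, homDim Z Y n = ∑ᶠ n, homDim X Z n := by
  rw [← finsum_comp_equiv (Equiv.addRight (1 : ℤ)), ← finsum_comp_equiv (Equiv.neg ℤ)]
  have h₁ := h.homDim_eq Z
  rw [homDim_shift_right] at h₁
  refine finsum_congr fun n => ?_
  simpa using congrFun h₁ (-n)

theorem HomFinite.homDim_zero_pos {A : C} (h : HomFinite A A) (hA : ¬IsZero A) :
    1 ≤ homDim A A 0 := by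
  have := h.finiteDimensional 0
  rw [homDim, Nat.one_le_iff_ne_zero]
  intro h0
  rw [Module.finrank_zero_iff] at h0
  refine hA ((IsZero.iff_id_eq_zero A).2 ?_)
  rw [← cancel_mono ((shiftFunctorZero C ℤ).inv.app A)]
  exact Subsingleton.elim _ _

theorem homDim_zero (A B : C) : homDim A B 0 = Module.finrank ℂ (A ⟶ B) :=
  (Linear.homCongr ℂ (Iso.refl A) ((shiftFunctorZero C ℤ).app B)).finrank_eq

/-- If the total dimension of the endomorphisms of a nonzero object is one, so is its Euler form. -/
theorem HomFinite.eulerForm_self_of_finsum_eq_one {A : C} (h : HomFinite A A) (hA : ¬IsZero A)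
    (h₁ : ∑ᶠ n, homDim A A n = 1) : eulerForm A A = 1 := by
  have h₀ := h.homDim_zero_pos hA
  have h₂ : homDim A A 0 ≤ ∑ᶠ k : ℤ, homDim A A (2 * k) :=
    single_le_finsum (f := fun k : ℤ => homDim A A (2 * k)) 0
      (Set.Finite.preimage (f := fun k : ℤ => 2 * k) (fun a _ b _ h => by simpa using h)
        h.finite_support) fun _ => Nat.zero_le _
  rw [finsum_eq_finsum_even_add_finsum_odd _ h.finite_support] at h₁
  rw [eulerForm, alternatingSum_eq_sub h.finite_support]
  omega

theorem HomFinite.eulerForm_self_of_finsum_eq_two {A : C} (h : HomFinite A A) (hA : ¬IsZero A)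
    (h₁ : ∑ᶠ n, homDim A A n = 2) : eulerForm A A = 2 ∨
      eulerForm A A = 0 ∧ Module.finrank ℂ (A ⟶ A) = 1 := by
  have h₀ := h.homDim_zero_pos hA
  have h₂ : homDim A A 0 ≤ ∑ᶠ k : ℤ, homDim A A (2 * k) :=
    single_le_finsum (f := fun k : ℤ => homDim A A (2 * k)) 0
      (Set.Finite.preimage (f := fun k : ℤ => 2 * k) (fun a _ b _ h => by simpa using h)
        h.finite_support) fun _ => Nat.zero_le _
  rw [finsum_eq_finsum_even_add_finsum_odd _ h.finite_support] at h₁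
  rw [eulerForm, alternatingSum_eq_sub h.finite_support, ← homDim_zero]
  omega

theorem eulerForm_eq_zero_of_finsum_eq_zero {A B : C} (h : HomFinite A B)
    (h₁ : ∑ᶠ n, homDim A B n = 0) : eulerForm A B = 0 := by
  rw [finsum_eq_finsum_even_add_finsum_odd _ h.finite_support] at h₁
  rw [eulerForm, alternatingSum_eq_sub h.finite_support]
  omega

theorem finsum_homDim_of_isZero {A : C} (hA : IsZero A) (B : C) : ∑ᶠ n, homDim A B n = 0 := by
  rw [← finsum_zero (α := ℤ)]
  refine finsum_congr fun n => ?_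
  have : Subsingleton (A ⟶ B⟦n⟧) := ⟨fun f g => hA.eq_of_src f g⟩
  exact Module.finrank_zero_of_subsingleton

end SerreDual

/-! ### Orbits in the root category -/

section RootCategory

variable {r : ℕ}

theorem eDerived_homFinite [Fact (6 ≤ r)] (A B : EDerived r) : HomFinite A B :=
  generates_eProj.homFinite homFinite_eProj A B

/-- The periodicity of the orbit is given only in the root category; this carries it over to the
Grothendieck group. -/
theorem RootCategory.eulerForm_congr [Fact (6 ≤ r)] {X Y : RootCategory r} (e : X ≅ Y)
    (Z : EDerived r) : eulerForm Z X.obj = eulerForm Z Y.obj := by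
  have h (Z : EDerived r) : Module.finrank ℂ (OrbitHom Z X.obj) =
      Module.finrank ℂ (OrbitHom Z Y.obj) :=
    (Linear.homCongr ℂ (Iso.refl (RootCategory.mk Z)) e).finrank_eq
  rw [(eDerived_homFinite _ _).eulerForm_eq_finrank_sub,
    (eDerived_homFinite _ _).eulerForm_eq_finrank_sub, h, h]

theorem HasSphericalSum.sum_homDim [Fact (6 ≤ r)] {A : RootCategory r} {B : ℕ → RootCategory r}
    {p : ℕ} (h : HasSphericalSum A B p) :
    ∑ k ∈ Finset.range p, ∑ᶠ n, homDim A.obj (B k).obj n = 2 := by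
  have h₁ : ((∑ k ∈ Finset.range p, ∑ᶠ n, homDim A.obj (B k).obj n : ℕ) : Cardinal) = 2 := by
    rw [Nat.cast_sum, ← h]
    exact Finset.sum_congr rfl fun k _ => (eDerived_homFinite _ _).rank_orbitHom_add.symm
  exact_mod_cast h₁

theorem IsTauOrbit.false_of_hasSphericalSum (hr : r = 6 ∨ r = 7 ∨ r = 8) {A : RootCategory r}
    {B : ℕ → RootCategory r} (hB : IsTauOrbit A B) {p : ℕ} (hp : 0 < p) {s : ℤ}
    (hs : s = 1 ∨ s = -1) (hps : ∀ Z, eulerForm Z (B p).obj = s * eulerForm Z A.obj)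
    (hsum : HasSphericalSum A B p) : False := by
  have : Fact (6 ≤ r) := ⟨by omega⟩
  obtain ⟨rfl, hserre⟩ := hB
  have hsum := hsum.sum_homDim
  choose y hy hy' using fun k => generates_eProj.exists_class (homFinite_eProj (r := r)) (B k).obj
  have hPB (k : ℕ) (i : Fin r) : eulerForm (eProj r i) (B k).obj = ∑ j, eCartan r i j * y k j := by
    rw [hy']
    exact Finset.sum_congr rfl fun j _ => by rw [eulerForm_eProj_eProj, mul_comm]
  have hcox (k : ℕ) : IsCoxeterImage r (y k) (y (k + 1)) := fun i => by
    rw [← hPB, (hserre k).eulerForm_eq_neg, hy]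
    simp only [eulerForm_eProj_eProj]
  have hform (k : ℕ) : eulerForm (B 0).obj (B k).obj = eForm r (y 0) (y k) := by
    rw [hy, eForm]
    refine Finset.sum_congr rfl fun i _ => ?_
    rw [hPB, Finset.mul_sum]
    exact Finset.sum_congr rfl fun j _ => by ring
  -- The vectors `y k` were merely chosen to compute Euler forms, so their equality is deduced from
  -- equal pairings with the projectives. Writing `p = q + 1` turns this into uniqueness of the
  -- Coxeter image of `y q`.
  have hper : y p = s • y 0 := by
    obtain ⟨q, rfl⟩ := Nat.exists_eq_succ_of_ne_zero hp.ne'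
    refine (hcox q).unique hr fun i => ?_
    rw [← hcox q i, ← hPB, hps, hPB, Finset.mul_sum]
    exact Finset.sum_congr rfl fun j _ => by rw [Pi.smul_apply, smul_eq_mul]; ring
  have hne : ¬IsZero (B 0).obj := fun h0 => by
    rw [Finset.sum_eq_zero fun k _ => finsum_homDim_of_isZero h0 _] at hsum
    omega
  have hfin := eDerived_homFinite (B 0).obj (B 0).obj
  rcases (show 1 ≤ p from hp).eq_or_lt with rfl | hp2
  · rw [Finset.sum_range_one] at hsum
    have h := eForm_self_ne_of_coxeter_fixed hr (hcox 0) hs hper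
    rw [← hform] at h
    rcases hfin.eulerForm_self_of_finsum_eq_two hne hsum with h₂ | ⟨h₀, hend⟩
    · exact h.1 h₂
    · refine hne (isZero_of_eulerForm_eProj_eq_zero hend fun i => ?_)
      rw [hPB, h.2 h₀]
      simp
  · have hpos := hfin.homDim_zero_pos hne
    have h₀ : homDim (B 0).obj (B 0).obj 0 ≤ ∑ᶠ n, homDim (B 0).obj (B 0).obj n :=
      single_le_finsum 0 hfin.finite_support fun _ => Nat.zero_le _
    have h₁ := (hserre 0).finsum_homDim_eq (B 0).obj
    obtain ⟨q, rfl⟩ := Nat.exists_eq_add_of_le' hp2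
    -- With `p = q + 2`, the terms `k = 0` and `k = 1` are split off. They are equal and at least 1,
    -- so they exhaust the sum 2 and the remaining terms vanish.
    rw [Finset.sum_range_succ', Finset.sum_range_succ', zero_add, h₁] at hsum
    refine not_coxeter_periodic hr hcox hp2 hs hper ?_ fun k hk hkq => ?_
    · rw [← hform]
      exact hfin.eulerForm_self_of_finsum_eq_one hne (by omega)
    · rw [← hform]
      refine eulerForm_eq_zero_of_finsum_eq_zero (eDerived_homFinite _ _) ?_
      obtain ⟨l, rfl⟩ := Nat.exists_eq_add_of_le' hk
      have hz : ∑ k ∈ Finset.range q, ∑ᶠ n, homDim (B 0).obj (B (k + 1 + 1)).obj n = 0 := by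
        omega
      exact Finset.sum_eq_zero_iff.1 hz l (Finset.mem_range.2 (by omega))

end RootCategory

end

/-! ### The theorem: orbits correspond to `s = 1`, half-orbits to `s = -1`, the sign of the shift.
-/

theorem mainTheorem9 (r : ℕ) (hr : r = 6 ∨ r = 7 ∨ r = 8) :
    ¬ ∃ (A : RootCategory r) (p : ℕ), HasSphericalOrbit A p ∨ HasSphericalHalfOrbit A p := by
  have : Fact (6 ≤ r) := ⟨by omega⟩
  rintro ⟨A, p, ⟨B, hB, ⟨⟨hp, ⟨e⟩⟩, -⟩, hsum⟩ | ⟨B, hB, ⟨⟨hp, ⟨e⟩⟩, -⟩, hsum⟩⟩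
  · refine hB.false_of_hasSphericalSum hr hp (Or.inl rfl) (fun Z => ?_) hsum
    rw [one_mul, RootCategory.eulerForm_congr e]
  · refine hB.false_of_hasSphericalSum hr hp (Or.inr rfl) (fun Z => ?_) hsum
    rw [RootCategory.eulerForm_congr e, RootCategory.shift, eulerForm_shift_right,
      Int.negOnePow_one]
    simp
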